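/- Conventions. Graphs are simple and of arbitrary cardinality. A ray is a one-sided infinite path with distinct vertices. Two rays of $G$ are equivalent if for every finite $S\subseteq V(G)$ they have tails in the same component of $G-S$; the equivalence classes are the ends of $G$. An end $\omega$ lies in a set $U\subseteq V(G)$ if every ray of $\omega$ has all but finitely many of its vertices in $U$. A separation of $G$ is a pair $(A,B)$ with $A\cup B=V(G)$ and no edge between $A\setminus B$ and $B\setminus A$; it is proper if both of these sets are non-empty; its order is $|A\cap B|$. A vertex $v$ dominates $\omega$ if there is no separation $(A,B)$ of finite order with $v\in A\setminus B$ such that $\omega$ lies in $B$; $\omega$ is undominated if no vertex dominates it. The end $\omega$ has vertex degree $k\in\mathbb N$ if $k$ is the maximal cardinality of a family of pairwise disjoint rays belonging to $\omega$. A tree-decomposition of $G$ consists of a tree $T$ and sets $P_t\subseteq V(G)$ $(t\in V(T))$ such that $V(G)=\bigcup_t P_t$, every edge of $G$ has both endpoints in some $P_t$, and $P_{t_1}\cap P_{t_3}\subseteq P_{t_2}$ whenever $t_2$ lies on the path from $t_1$ to $t_3$ in $T$. For an edge $st$ of $T$ let $T_s$ and $T_t$ be the components of $T-st$ containing $s$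 and $t$, and put $X_s=\bigcup_{u\in T_s}P_u$ and $X_t=\bigcup_{u\in T_t}P_u$; the pairs $(X_s,X_t)$ and $(X_t,X_s)$ are the separations associated to $st$. The adhesion is the supremum of $|X_s\cap X_t|$ over all edges $st$ of $T$. Theorem. Let $G$ be a connected graph with exactly one end $\omega$, and suppose that $\omega$ is undominated and has finite vertex degree $k$. Then $G$ has a tree-decomposition $(T,(P_t)_{t\in V(T)})$ of adhesion $k$, all of whose associated separations are proper separations of $G$, such that 1. it displays $\omega$: the tree $T$ has exactly one end $\mu$, and for every edge $st$ of $T$ such that $\mu$ lies in $T_t$, the end $\omega$ lies in $X_t$; and 2. it is $\mathrm{Aut}(G)$-invariant: for every automorphism $\varphi$ of $G$ and every associated separation $(A,B)$, the pair $(\varphi(A),\varphi(B))$ is again an associated separation. -/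

import Mathlib

universe u v

/-! Graphs are simple graphs on a vertex set of arbitrary cardinality. -/

namespace EndTD

section Ends

variable {V : Type u}

/-- A ray in `G`: a one-sided infinite path `v₀, v₁, …` with pairwise distinct vertices. -/
structure Ray (G : SimpleGraph V) where
  /-- The `n`-th vertex of the ray. -/
  vert : ℕ → V
  injective : Function.Injective vert
  adj : ∀ n, G.Adj (vert n) (vert (n + 1))

/-- All but finitely many vertices of the ray belong to `S`. -/
def Ray.LiesIn {G : SimpleGraph V} (r : Ray G) (S : Set V) : Prop :=
  ∃ N, ∀ n, N ≤ n → r.vert n ∈ S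

/-- Two rays are equivalent if, for every finite set `S` of vertices, they lie in the same
component of `G - S`. -/
def Ray.Equivalent {G : SimpleGraph V} (r r' : Ray G) : Prop :=
  ∀ S : Set V, S.Finite →
    ∃ C : G.ComponentCompl S, r.LiesIn (C : Set V) ∧ r'.LiesIn (C : Set V)

theorem Ray.exists_component {G : SimpleGraph V} (r : Ray G) {S : Set V} (hS : S.Finite) :
    ∃ C : G.ComponentCompl S, r.LiesIn (C : Set V) := by
  have hfin : (r.vert ⁻¹' S).Finite := hS.preimage r.injective.injOn
  obtain ⟨N, hN⟩ := hfin.bddAbove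
  have hout : ∀ n, N + 1 ≤ n → r.vert n ∉ S := by
    intro n hn hmem
    have := hN hmem
    omega
  refine ⟨G.componentComplMk (hout (N + 1) le_rfl), N + 1, fun n hn => ?_⟩
  induction n, hn using Nat.le_induction with
  | base => exact G.componentComplMk_mem _
  | succ n hn ih =>
    exact SimpleGraph.ComponentCompl.mem_of_adj _ _ ih (hout (n + 1) (by omega)) (r.adj n)

theorem Ray.component_unique {G : SimpleGraph V} (r : Ray G) {S : Set V}
    {C D : G.ComponentCompl S} (hC : r.LiesIn (C : Set V)) (hD : r.LiesIn (D : Set V)) :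
    C = D := by
  obtain ⟨N, hN⟩ := hC
  obtain ⟨M, hM⟩ := hD
  obtain ⟨_, h⟩ := hN (max N M) (le_max_left _ _)
  obtain ⟨_, h'⟩ := hM (max N M) (le_max_right _ _)
  exact h.symm.trans h'

/-- The setoid of rays under equivalence. -/
instance raySetoid (G : SimpleGraph V) : Setoid (Ray G) where
  r := Ray.Equivalent
  iseqv :=
    { refl := fun r S hS => (r.exists_component hS).imp fun _ h => ⟨h, h⟩
      symm := fun h S hS => (h S hS).imp fun _ h => ⟨h.2, h.1⟩
      trans := by
        intro a b c hab hbc S hS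
        obtain ⟨C, haC, hbC⟩ := hab S hS
        obtain ⟨D, hbD, hcD⟩ := hbc S hS
        obtain rfl := b.component_unique hbC hbD
        exact ⟨C, haC, hcD⟩ }

/-- The (vertex) ends of `G`: the equivalence classes of rays. -/
def GraphEnd (G : SimpleGraph V) : Type u := Quotient (raySetoid G)

/-- The ray `r` belongs to the end `ω`. -/
def Ray.BelongsTo {G : SimpleGraph V} (r : Ray G) (ω : GraphEnd G) : Prop :=
  Quotient.mk (raySetoid G) r = ω

/-- `ω` is an end of `G` and there is no other one. -/
def IsOnlyEnd (G : SimpleGraph V) (ω : GraphEnd G) : Prop :=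
  ∀ ν : GraphEnd G, ν = ω

/-- Every ray of the end has all but finitely many of its vertices in `S`. For the component of
`G - S'` with `S'` finite, or for a side of a separation of finite order, this says that the end
lies in that component or in that side. -/
def GraphEnd.LiesIn {G : SimpleGraph V} (ω : GraphEnd G) (S : Set V) : Prop :=
  ∀ r : Ray G, r.BelongsTo ω → r.LiesIn S

/-- `(A, B)` is a separation of `G`. -/
structure IsSeparation (G : SimpleGraph V) (A B : Set V) : Prop where
  union_eq : A ∪ B = Set.univ
  not_adj : ∀ x ∈ A \ B, ∀ y ∈ B \ A, ¬ G.Adj x y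

/-- `(A, B)` is a proper separation of `G`. -/
structure IsProperSeparation (G : SimpleGraph V) (A B : Set V) : Prop
    extends IsSeparation G A B where
  left_nonempty : (A \ B).Nonempty
  right_nonempty : (B \ A).Nonempty

/-- The vertex `x` dominates the end `ω`: no separation of finite order has `x` strictly on one
side and `ω` on the other. -/
def Dominates {G : SimpleGraph V} (x : V) (ω : GraphEnd G) : Prop :=
  ¬ ∃ A B : Set V, IsSeparation G A B ∧ (A ∩ B).Finite ∧ x ∈ A \ B ∧ ω.LiesIn B

/-- No vertex dominates `ω`. -/
def GraphEnd.Undominated {G : SimpleGraph V} (ω : GraphEnd G) : Prop :=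
  ∀ x : V, ¬ Dominates x ω

/-- The vertex degree of `ω` is the natural number `k`: the maximal cardinality of a family of
pairwise disjoint rays belonging to `ω` is `k`. (An infinite such family would contain finite ones
of every size, and then no `k` qualifies.) -/
def GraphEnd.HasVertexDegree {G : SimpleGraph V} (ω : GraphEnd G) (k : ℕ) : Prop :=
  IsGreatest {n : ℕ | ∃ R : Fin n → Ray G, (∀ i, (R i).BelongsTo ω) ∧
    Pairwise fun i j => Disjoint (Set.range (R i).vert) (Set.range (R j).vert)} k

end Ends

section TreeDecompositions

variable {V : Type u} {I : Type v}

/-- The vertex set of the component containing `s` of the graph obtained from `T` by removing the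
edge `st` (its two ends are kept). -/
def edgeSide (T : SimpleGraph I) (s t : I) : Set I :=
  {w | (T.deleteEdges {s(s, t)}).Reachable s w}

/-- A tree-decomposition of `G` whose decomposition tree has vertex set `I`. -/
structure TreeDecomposition (G : SimpleGraph V) (I : Type v) where
  /-- The decomposition tree. -/
  tree : SimpleGraph I
  isTree : tree.IsTree
  /-- The parts. -/
  part : I → Set V
  exists_mem_part : ∀ x : V, ∃ t, x ∈ part t
  exists_edge_part : ∀ x y : V, G.Adj x y → ∃ t, x ∈ part t ∧ y ∈ part t
  inter_subset : ∀ (t₁ t₂ t₃ : I) (p : tree.Path t₁ t₃), t₂ ∈ p.1.support →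
    part t₁ ∩ part t₃ ⊆ part t₂

variable {G : SimpleGraph V}

/-- For an edge `st` of the decomposition tree, the union `X_s` of the parts on the side of `s`.
The separation associated to the edge is `(D.side s t, D.side t s)`. -/
def TreeDecomposition.side (D : TreeDecomposition G I) (s t : I) : Set V :=
  ⋃ w ∈ edgeSide D.tree s t, D.part w

/-- The set of all separations associated to edges of the decomposition tree, where every edge
contributes both orientations. -/
def TreeDecomposition.separations (D : TreeDecomposition G I) : Set (Set V × Set V) :=
  {p | ∃ s t : I, D.tree.Adj s t ∧ p = (D.side s t, D.side t s)}

/-- The adhesion: the supremum of the sizes of the adhesion sets. -/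
noncomputable def TreeDecomposition.adhesion (D : TreeDecomposition G I) : ℕ∞ :=
  ⨆ p ∈ D.separations, (p.1 ∩ p.2).encard

/-- The separation associated to every edge of the decomposition tree is proper. -/
def TreeDecomposition.IsProper (D : TreeDecomposition G I) : Prop :=
  ∀ p ∈ D.separations, IsProperSeparation G p.1 p.2

/-- A tree-decomposition (of finite adhesion) displays the end `ω`: its decomposition tree has
exactly one end `μ`, and for every edge `st` with `μ` on the side of `t`, the end `ω` lies in the
side `X_t` of the associated separation `(X_s, X_t)`. -/
def TreeDecomposition.Displays (D : TreeDecomposition G I) (ω : GraphEnd G) : Prop :=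
  D.adhesion ≠ ⊤ ∧
  ∃ μ : GraphEnd D.tree, IsOnlyEnd D.tree μ ∧
    ∀ s t : I, D.tree.Adj s t → μ.LiesIn (edgeSide D.tree t s) → ω.LiesIn (D.side t s)

/-- A tree-decomposition is `Aut(G)`-invariant if every automorphism of `G` maps associated
separations to associated separations. -/
def TreeDecomposition.IsAutInvariant (D : TreeDecomposition G I) : Prop :=
  ∀ φ : G ≃g G, ∀ p ∈ D.separations, (φ '' p.1, φ '' p.2) ∈ D.separations

end TreeDecompositions

end EndTD

/-!
A set `A` of vertices encodes the separation `(A, V \ intr A)`, whose separator is the boundary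
`bdry A`. Since `G` has only one end, the end lies on the far side of `A` as soon as every ray is
eventually outside `A` (`RayFree`). A ray-free set in which `k` disjoint rays start has at least `k`
boundary vertices, so that the sizes of boundaries can be compared by submodularity.

*Small separators.* Every finite set is in the interior of a ray-free set with at most `k` boundary
vertices (`FinitelySeparable.exists_encard_le`): otherwise Menger's theorem
(`linked_of_le_encard`), applied between the boundaries of consecutive members of a sequence of
ray-free sets with smallest possible boundaries, and König's lemma (`exists_ray_of_walks`) give more
than `k` disjoint rays. Hence there is an exhaustion `A 0 ⊆ A 1 ⊆ ⋯` of `G` by ray-free sets with `k`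
boundary vertices, where `bdry (A n)` lies in a connected set `H n` between `A n` and `A (n + 1)`.

*No shifts.* An automorphism `φ` with `A ⊆ φ A` fixes the boundary of `A`
(`RayFree.bdry_eq_of_subset_image`), since otherwise the backward images of a segment of a ray form
a ray in a ray-free set. Therefore no translate of the interior of `A 0` meets `bdry (A n)` for
`n > k` (`Exhaustion.disjoint_image_intr_bdry`): of the `k` disjoint connected sets `φ (H i)` with
`i < k`, one misses `bdry (A n)`, and then either `A n ∪ φ (A i)` or `A n \ φ (A i)` has a boundary
that is too small, or `A (i + 1) ⊆ φ (A i)`. So in a subsequence, the boundary of each member is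
disjoint from all translates of the connected sets `W m` around the earlier members (`Tower`).

*Nested levels.* Let `D n` be the smallest ray-free set that contains `W n`, has `k` boundary
vertices, and whose boundary avoids all translates of `W 0, …, W n`. Translates of sets from
different levels are nested because the translate on the lower level is contained in a translate of
some `W m` that the higher one does not cut (`Tower.image_D_subset_or_disjoint`). Translates of the
same `D n` are nested by minimality and submodularity (`Tower.image_D_eq_or_disjoint`). Every
translate of `D n` is contained in a unique translate of `D (n + 1)`; these parent relations form a
one-ended tree, and they turn the nested family into the required tree-decomposition
(`LevelSystem.treeDecomposition`).
-/

namespace EndTD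

/-! ### Menger's theorem -/

section Menger

variable {V : Type u}

/-- `ReachAvoid G X S v`: some walk of `G` from a vertex of `X` to `v` has no vertex in `S`. -/
inductive ReachAvoid (G : SimpleGraph V) (X S : Set V) : V → Prop
  | base {v : V} : v ∈ X → v ∉ S → ReachAvoid G X S v
  | step {v w : V} : ReachAvoid G X S v → G.Adj v w → w ∉ S → ReachAvoid G X S w

theorem ReachAvoid.notMem {G : SimpleGraph V} {X S : Set V} {v : V} (h : ReachAvoid G X S v) :
    v ∉ S := by
  cases h <;> assumption

theorem ReachAvoid.reverse {G : SimpleGraph V} {X S : Set V} {v : V} (h : ReachAvoid G X S v) :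
    ∃ u ∈ X, ReachAvoid G {v} S u := by
  induction h with
  | @base v hv hS => exact ⟨v, hv, .base rfl hS⟩
  | @step a b ha hab hb ih =>
    obtain ⟨u, hu, h⟩ := ih
    refine ⟨u, hu, ?_⟩
    clear hu
    induction h with
    | base h hS => obtain rfl := h; exact .step (.base rfl hb) hab.symm hS
    | step _ h1 h2 ih => exact .step ih h1 h2

theorem ReachAvoid.mono {G G' : SimpleGraph V} (hG : G ≤ G') {X X' S S' : Set V} (hX : X ⊆ X')
    (hS : S' ⊆ S) {v : V} (h : ReachAvoid G X S v) : ReachAvoid G' X' S' v := by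
  induction h with
  | base h1 h2 => exact .base (hX h1) fun h => h2 (hS h)
  | step _ h1 h2 ih => exact .step ih (hG h1) fun h => h2 (hS h)

/-- Every walk of `G` from `X` to `Y` has a vertex in `S`. -/
def Separates (G : SimpleGraph V) (X Y S : Set V) : Prop :=
  ∀ v ∈ Y, ¬ ReachAvoid G X S v

theorem Separates.symm {G : SimpleGraph V} {X Y S : Set V} (h : Separates G X Y S) :
    Separates G Y X S := by
  intro v hv hr
  obtain ⟨u, hu, h'⟩ := hr.reverse
  exact h u hu (h'.mono le_rfl (Set.singleton_subset_iff.2 hv) le_rfl)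

/-- There are `l` pairwise disjoint walks of `G` from `X` to `Y`. -/
def Linked (G : SimpleGraph V) (X Y : Set V) (l : ℕ) : Prop :=
  ∃ (a b : Fin l → V) (p : ∀ i, G.Walk (a i) (b i)), (∀ i, a i ∈ X) ∧ (∀ i, b i ∈ Y) ∧
    ∀ i j, i ≠ j → ∀ v ∈ (p i).support, v ∉ (p j).support

theorem Linked.mono {G G' : SimpleGraph V} (hG : G ≤ G') {X Y : Set V} {l : ℕ}
    (h : Linked G X Y l) : Linked G' X Y l := by
  obtain ⟨a, b, p, ha, hb, hp⟩ := h
  exact ⟨a, b, fun i => (p i).mapLe hG, ha, hb, by simpa using hp⟩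

/-- A walk ending in `Z` can be stopped at its first vertex in `Z`. -/
theorem exists_truncated_walk {G : SimpleGraph V} (Z : Set V) {u v : V} (p : G.Walk u v)
    (hv : v ∈ Z) : ∃ z ∈ Z, ∃ q : G.Walk u z, q.support ⊆ p.support ∧
      ∀ t ∈ q.support, t ≠ z → ReachAvoid G {u} Z t := by
  induction p with
  | @nil u => exact ⟨u, hv, .nil, by simp, by simp⟩
  | @cons u w v h p ih =>
    by_cases hu : u ∈ Z
    · exact ⟨u, hu, .nil, by simp, by simp⟩
    · obtain ⟨z, hz, q, hq, ht⟩ := ih hv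
      refine ⟨z, hz, .cons h q, ?_, ?_⟩
      · intro t
        simp only [SimpleGraph.Walk.support_cons, List.mem_cons]
        exact Or.imp id fun h => hq h
      · intro t htq htz
        simp only [SimpleGraph.Walk.support_cons, List.mem_cons] at htq
        rcases htq with rfl | htq
        · exact .base rfl hu
        · have := ht t htq htz
          clear htq htz
          induction this with
          | base h1 h2 => obtain rfl := h1; exact .step (.base rfl hu) h h2
          | step _ h1 h2 ih => exact .step ih h1 h2

/-- If `Z` has exactly `l` elements, then `l` disjoint walks from `X` to `Z` can be chosen to end in
the different elements of `Z` and to avoid `Z` before their ends. -/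
theorem Linked.exists_truncated {G : SimpleGraph V} {X Z : Set V} {l : ℕ} (h : Linked G X Z l)
    (hZ : Z.encard = l) :
    ∃ (a b : Fin l → V) (p : ∀ i, G.Walk (a i) (b i)), (∀ i, a i ∈ X) ∧
      (∀ i, b i ∈ Z) ∧ (∀ z ∈ Z, ∃ i, b i = z) ∧ Function.Injective b ∧
      (∀ i j, i ≠ j → ∀ v ∈ (p i).support, v ∉ (p j).support) ∧
      ∀ i, ∀ t ∈ (p i).support, t ≠ b i → ReachAvoid G X Z t := by
  obtain ⟨a, b, p, ha, hb, hp⟩ := h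
  choose z hz q hq ht using fun i => exists_truncated_walk Z (p i) (hb i)
  have hdisj : ∀ i j, i ≠ j → ∀ v ∈ (q i).support, v ∉ (q j).support :=
    fun i j hij v hv hv' => hp i j hij v (hq i hv) (hq j hv')
  have hinj : Function.Injective z := by
    intro i j hij
    by_contra hne
    exact hdisj i j hne (z i) (q i).end_mem_support (by rw [hij]; exact (q j).end_mem_support)
  refine ⟨a, z, q, ha, hz, ?_, hinj, hdisj, fun i t h1 h2 =>
    (ht i t h1 h2).mono le_rfl (Set.singleton_subset_iff.2 (ha i)) le_rfl⟩
  have hfin : Z.Finite := Set.finite_of_encard_eq_coe hZ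
  have heq : Set.range z = Z := by
    refine hfin.eq_of_subset_of_encard_le' (by rintro _ ⟨i, rfl⟩; exact hz i) ?_
    rw [hZ, ← Set.image_univ, hinj.encard_image, Set.encard_univ]
    simp
  intro y hy
  rw [← heq] at hy
  exact hy

/-- If `S` separates `X` from `Y` in the graph `G'` that arises from `G` by deleting the edge `xy`,
and `y` is on the side of `Y`, then every separator of `X` and `S ∪ {x}` in `G'` separates
`X` from `Y` in `G`. -/
theorem Separates.of_insert {G G' : SimpleGraph V} {X Y S T : Set V} {x y : V}
    (hG : ∀ a b, G.Adj a b → G'.Adj a b ∨ (a = x ∧ b = y) ∨ (a = y ∧ b = x))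
    (hS : Separates G' X Y S) (hy : ¬ ReachAvoid G' X S y)
    (hT : Separates G' X (insert x S) T) : Separates G X Y T := by
  have h1 : ∀ v, ReachAvoid G' X T v → ReachAvoid G' X S v := by
    intro v hv
    have hvS : v ∉ S := fun h => hT v (Set.mem_insert_of_mem _ h) hv
    induction hv with
    | base h _ => exact .base h hvS
    | @step a b ha hab hb ih =>
      exact .step (ih fun h => hT a (Set.mem_insert_of_mem _ h) ha) hab hvS
  have h2 : ∀ v, ReachAvoid G X T v → ReachAvoid G' X T v := by
    intro v hv
    induction hv with
    | base h h' => exact .base h h'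
    | @step a b ha hab hb ih =>
      rcases hG a b hab with h | ⟨rfl, rfl⟩ | ⟨rfl, rfl⟩
      · exact .step ih h hb
      · exact absurd ih (hT a (Set.mem_insert _ _))
      · exact absurd (h1 _ ih) hy
  exact fun v hv hr => hS v hv (h1 _ (h2 _ hr))

/-- Menger's theorem for graphs with finitely many edges, by induction on the number of edges. If
deleting the edge `xy` creates a separator `S` with fewer than `l` vertices, then `S ∪ {x}` and
`S ∪ {y}` have exactly `l` vertices, and walks from `X` to the former and from `Y` to the latter are
joined in `S` and along `xy`. -/
theorem linked_of_finite_edgeSet (n : ℕ) : ∀ (G : SimpleGraph V), G.edgeSet.encard = n →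
    ∀ (X Y : Set V) (l : ℕ), (∀ S, Separates G X Y S → (l : ℕ∞) ≤ S.encard) →
      Linked G X Y l := by
  classical
  induction n with
  | zero =>
    intro G hG X Y l hl
    have hbot : ∀ a b, ¬ G.Adj a b := by
      intro a b hab
      have : s(a, b) ∈ G.edgeSet := hab
      rw [Nat.cast_zero, Set.encard_eq_zero] at hG
      simp [hG] at this
    have hXY : (l : ℕ∞) ≤ (X ∩ Y).encard := by
      apply hl
      intro v hv hr
      cases hr with
      | base h1 h2 => exact h2 ⟨h1, hv⟩
      | step _ h _ => exact hbot _ _ h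
    obtain ⟨t, ht, hcard⟩ := Set.exists_subset_encard_eq hXY
    have hfin : t.Finite := Set.finite_of_encard_eq_coe hcard
    have hc : hfin.toFinset.card = l := by
      rw [hfin.encard_eq_coe_toFinset_card] at hcard
      exact_mod_cast hcard
    let e := (hfin.toFinset.equivFinOfCardEq hc).symm
    have he : ∀ i, (e i : V) ∈ t := fun i => hfin.mem_toFinset.1 (e i).2
    refine ⟨fun i => e i, fun i => e i, fun i => .nil, fun i => (ht (he i)).1,
      fun i => (ht (he i)).2, ?_⟩
    intro i j hij v hv hv'
    simp only [SimpleGraph.Walk.support_nil, List.mem_singleton] at hv hv'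
    exact hij (e.injective (Subtype.ext (hv.symm.trans hv')))
  | succ n ih =>
    intro G hG X Y l hl
    have hne : G.edgeSet.Nonempty := by
      rw [← Set.encard_pos, hG]
      exact_mod_cast Nat.succ_pos n
    obtain ⟨e, he⟩ := hne
    set G' := G.deleteEdges {e} with hG'
    have hle : G' ≤ G := SimpleGraph.deleteEdges_le _
    have hG'n : G'.edgeSet.encard = n := by
      have := Set.encard_sdiff_singleton_add_one he
      rw [hG, ← SimpleGraph.edgeSet_deleteEdges, ← hG', Nat.cast_succ] at this
      exact ENat.add_left_injective_of_ne_top ENat.one_ne_top this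
    by_cases hcase : ∀ S, Separates G' X Y S → (l : ℕ∞) ≤ S.encard
    · exact (ih G' hG'n X Y l hcase).mono hle
    push Not at hcase
    obtain ⟨S, hS, hSl⟩ := hcase
    have hGG' : ∀ a b, G.Adj a b → G'.Adj a b ∨ s(a, b) = e := by
      intro a b hab
      by_cases h : s(a, b) = e
      · exact .inr h
      · exact .inl (by simp [hG', SimpleGraph.deleteEdges_adj, hab, h])
    -- The end `x` of `e` is on the side of `X` and the other end `y` on the side of `Y`.
    obtain ⟨x, y, hxy, hxP, hyQ⟩ : ∃ x y, s(x, y) = e ∧ ReachAvoid G' X S x ∧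
        ReachAvoid G' Y S y := by
      have key : ∀ X Y : Set V, ¬ Separates G X Y S → Separates G' X Y S →
          ∃ x y, s(x, y) = e ∧ ReachAvoid G' X S x := by
        intro X Y hn hs
        by_contra hno
        push Not at hno
        apply hn
        intro v hv hr
        refine hs v hv ?_
        clear hv
        induction hr with
        | base h h' => exact .base h h'
        | @step a b _ hab hb ih =>
          rcases hGG' a b hab with h | h
          · exact .step ih h hb
          · exact absurd ih (hno a b h)
      have hn : ¬ Separates G X Y S := fun h => absurd (hl S h) (not_le.2 hSl)
      obtain ⟨x, y, hxy, hx⟩ := key X Y hn hS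
      obtain ⟨y', x', hxy', hy⟩ := key Y X (fun h => hn h.symm) hS.symm
      refine ⟨x, y, hxy, hx, ?_⟩
      rw [← hxy, Sym2.eq_iff] at hxy'
      rcases hxy' with ⟨rfl, rfl⟩ | ⟨rfl, rfl⟩
      · exfalso
        obtain ⟨u, hu, h⟩ := hy.reverse
        refine hS u hu ?_
        clear hu
        induction h with
        | base h _ => obtain rfl := h; exact hx
        | step _ h1 h2 ih => exact .step ih h1 h2
      · exact hy
    have hPQ : ∀ v, ReachAvoid G' X S v → ReachAvoid G' Y S v → False := by
      intro v hx hy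
      obtain ⟨u, hu, h⟩ := hy.reverse
      refine hS u hu ?_
      clear hu
      induction h with
      | base h _ => obtain rfl := h; exact hx
      | step _ h1 h2 ih => exact .step ih h1 h2
    have hadj : G.Adj x y := by rw [← hxy] at he; exact he
    have hG1 : ∀ a b, G.Adj a b → G'.Adj a b ∨ (a = x ∧ b = y) ∨ (a = y ∧ b = x) := by
      intro a b hab
      rcases hGG' a b hab with h | h
      · exact .inl h
      · rw [← hxy, Sym2.eq_iff] at h; exact .inr h
    have hG2 : ∀ a b, G.Adj a b → G'.Adj a b ∨ (a = y ∧ b = x) ∨ (a = x ∧ b = y) :=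
      fun a b hab => (hG1 a b hab).imp id Or.symm
    have hyP : ¬ ReachAvoid G' X S y := fun h => hPQ y h hyQ
    have hxQ : ¬ ReachAvoid G' Y S x := fun h => hPQ x hxP h
    have hX : ∀ T, Separates G' X (insert x S) T → (l : ℕ∞) ≤ T.encard :=
      fun T hT => hl T (hS.of_insert hG1 hyP hT)
    have hY : ∀ T, Separates G' Y (insert y S) T → (l : ℕ∞) ≤ T.encard :=
      fun T hT => hl T (hS.symm.of_insert hG2 hxQ hT).symm
    have hSself : ∀ (X Z : Set V), Z ⊆ S → Separates G' X Z S :=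
      fun X Z hZ v hv hr => hr.notMem (hZ hv)
    have hcardx : (insert x S).encard = l := by
      refine le_antisymm ?_ (hX _ fun v hv hr => hr.notMem hv)
      rw [Set.encard_insert_of_notMem hxP.notMem]
      exact Order.add_one_le_of_lt hSl
    have hcardy : (insert y S).encard = l := by
      refine le_antisymm ?_ (hY _ fun v hv hr => hr.notMem hv)
      rw [Set.encard_insert_of_notMem hyQ.notMem]
      exact Order.add_one_le_of_lt hSl
    obtain ⟨a, b, p, ha, hb, hbs, hbi, hp, hpr⟩ :=
      (ih G' hG'n X (insert x S) l hX).exists_truncated hcardx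
    obtain ⟨c, d, q, hc, hd, hds, hdi, hq, hqr⟩ :=
      (ih G' hG'n Y (insert y S) l hY).exists_truncated hcardy
    have hpP : ∀ i, ∀ t ∈ (p i).support, t ≠ b i → ReachAvoid G' X S t := fun i t h1 h2 =>
      (hpr i t h1 h2).mono le_rfl le_rfl (Set.subset_insert _ _)
    have hqQ : ∀ i, ∀ t ∈ (q i).support, t ≠ d i → ReachAvoid G' Y S t := fun i t h1 h2 =>
      (hqr i t h1 h2).mono le_rfl le_rfl (Set.subset_insert _ _)
    have hex : ∀ i, ∃ j, ((b i ∈ S ∧ d j = b i) ∨ (b i = x ∧ d j = y)) ∧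
        ∃ r : G.Walk (a i) (c j), ∀ v ∈ r.support, v ∈ (p i).support ∨ v ∈ (q j).support := by
      intro i
      rcases hb i with h | h
      · obtain ⟨j, hj⟩ := hds y (Set.mem_insert _ _)
        refine ⟨j, .inr ⟨h, hj⟩, ((p i).mapLe hle).append
          (.cons (by rw [h, hj]; exact hadj) ((q j).mapLe hle).reverse), ?_⟩
        intro v hv
        simp only [SimpleGraph.Walk.mem_support_append_iff, SimpleGraph.Walk.support_cons,
          List.mem_cons, SimpleGraph.Walk.support_reverse, List.mem_reverse,
          SimpleGraph.Walk.support_mapLe_eq_support] at hv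
        rcases hv with hv | rfl | hv
        · exact .inl hv
        · exact .inl (p i).end_mem_support
        · exact .inr hv
      · obtain ⟨j, hj⟩ := hds (b i) (Set.mem_insert_of_mem _ h)
        refine ⟨j, .inl ⟨h, hj⟩, ((p i).mapLe hle).append
          ((((q j).mapLe hle).reverse).copy hj rfl), ?_⟩
        intro v hv
        simpa using hv
    choose j hj r hr using hex
    have hji : ∀ i i', j i = j i' → i = i' := by
      intro i i' h
      apply hbi
      have h1 := hj i
      have h2 := hj i'
      rw [← h] at h2
      rcases h1 with ⟨s1, t1⟩ | ⟨s1, t1⟩ <;> rcases h2 with ⟨s2, t2⟩ | ⟨s2, t2⟩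
      · exact t1.symm.trans t2
      · exact absurd (t2 ▸ t1 ▸ s1) hyQ.notMem
      · exact absurd (t1 ▸ t2 ▸ s2) hyQ.notMem
      · exact s1.trans s2.symm
    -- Before their ends the two families of walks stay on different sides of `S`.
    have hmixed : ∀ i i', i ≠ i' → ∀ v ∈ (p i).support, v ∉ (q (j i')).support := by
      intro i i' hii v hv hv'
      by_cases h1 : v = b i <;> by_cases h2 : v = d (j i')
      · have hvx := hb i
        have hvy := hd (j i')
        rw [← h1] at hvx
        rw [← h2] at hvy
        have hvS : v ∈ S := by
          rcases hvx with rfl | h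
          · exact hvy.resolve_left hadj.ne
          · exact h
        rcases hj i with ⟨_, h⟩ | ⟨h, _⟩
        · exact hii (hji _ _ (hdi (h.trans (h1.symm.trans h2))))
        · rw [← h, ← h1] at hxP
          exact hxP.notMem hvS
      · have hQ := hqQ _ v hv' h2
        rcases hb i with h | h
        · rw [← h1] at h; subst h; exact hxQ hQ
        · exact hQ.notMem (h1 ▸ h)
      · have hP := hpP _ v hv h1
        rcases hd (j i') with h | h
        · rw [← h2] at h; subst h; exact hyP hP
        · exact hP.notMem (h2 ▸ h)
      · exact hPQ v (hpP _ v hv h1) (hqQ _ v hv' h2)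
    refine ⟨a, fun i => c (j i), r, ha, fun i => hc _, ?_⟩
    intro i i' hii v hv hv'
    rcases hr i v hv with h1 | h1 <;> rcases hr i' v hv' with h2 | h2
    · exact hp i i' hii v h1 h2
    · exact hmixed i i' hii v h1 h2
    · exact hmixed i' i hii.symm v h2 h1
    · exact hq _ _ (fun h => hii (hji _ _ h)) v h1 h2

/-- Menger's theorem. The reduction to finitely many edges takes a separator of the graph formed by
each finite set of edges, and as its limit along an ultrafilter a separator of `G`. -/
theorem linked_of_le_encard (G : SimpleGraph V) (X Y : Set V) (l : ℕ)
    (hl : ∀ S, Separates G X Y S → (l : ℕ∞) ≤ S.encard) : Linked G X Y l := by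
  classical
  by_contra hno
  let H : Finset (Sym2 V) → SimpleGraph V := fun E => .fromEdgeSet (↑E ∩ G.edgeSet)
  have hH : ∀ E, H E ≤ G := by
    intro E a b hab
    simp only [H, SimpleGraph.fromEdgeSet_adj] at hab
    exact hab.1.2
  have hsep : ∀ E, ∃ S, Separates (H E) X Y S ∧ S.encard < l := by
    intro E
    by_contra hE
    push Not at hE
    have hfin : (H E).edgeSet.Finite := by
      refine E.finite_toSet.subset fun e he => ?_
      simp only [H, SimpleGraph.edgeSet_fromEdgeSet] at he
      exact he.1.1
    obtain ⟨n, hn⟩ := ENat.ne_top_iff_exists.1 (Set.encard_ne_top_iff.2 hfin)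
    exact hno ((linked_of_finite_edgeSet n (H E) hn.symm X Y l hE).mono (hH E))
  choose S hS hSl using hsep
  let U : Ultrafilter (Finset (Sym2 V)) := .of Filter.atTop
  have hU : (U : Filter (Finset (Sym2 V))) ≤ Filter.atTop := Ultrafilter.of_le _
  let S' : Set V := {v | ∀ᶠ E in (U : Filter _), v ∈ S E}
  have hS' : Separates G X Y S' := by
    intro v hv hr
    have : ∀ᶠ E in (U : Filter _), ReachAvoid (H E) X (S E) v := by
      clear hv
      induction hr with
      | base h h' =>
        filter_upwards [Ultrafilter.eventually_not.2 h'] with E hE using .base h hE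
      | @step a b _ hab hb ih =>
        filter_upwards [ih, Ultrafilter.eventually_not.2 hb,
          hU (Filter.eventually_ge_atTop {s(a, b)})] with E h1 h2 h3
        refine .step h1 ?_ h2
        simp only [H, SimpleGraph.fromEdgeSet_adj]
        exact ⟨⟨h3 (Finset.mem_singleton_self _), hab⟩, hab.ne⟩
    obtain ⟨E, hE⟩ := this.exists
    exact hS E v hv hE
  obtain ⟨t, ht, hcard⟩ := Set.exists_subset_encard_eq (hl S' hS')
  have htfin : t.Finite := Set.finite_of_encard_eq_coe hcard
  have : ∀ᶠ E in (U : Filter _), ∀ v ∈ t, v ∈ S E :=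
    (Filter.eventually_all_finite htfin).2 fun v hv => ht hv
  obtain ⟨E, hE⟩ := this.exists
  exact absurd (hcard ▸ Set.encard_le_encard hE) (not_le.2 (hSl E))

end Menger

/-! ### Rays from sequences of walks -/

section Konig

variable {V : Type u}

/-- König's lemma: an infinite, connected, locally finite graph has a ray, here for the component
of `x` in `H`. The ray is a geodesic; `T v` below is the set of vertices that have a geodesic from
`x` through `v`. -/
theorem exists_ray_of_infinite_of_finite_neighborSet (H : SimpleGraph V) (x : V)
    (hfin : ∀ v, H.Reachable x v → (H.neighborSet v).Finite)
    (hinf : {v | H.Reachable x v}.Infinite) : ∃ r : Ray H, r.vert 0 = x := by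
  let T : V → Set V := fun v => {u | H.Reachable v u ∧ H.dist x u = H.dist x v + H.dist v u}
  have hstep : ∀ v, H.Reachable x v → (T v).Infinite →
      ∃ w, H.Adj v w ∧ H.dist x w = H.dist x v + 1 ∧ (T w).Infinite := by
    intro v hv hT
    by_contra hno
    push Not at hno
    apply hT
    have hsub : T v ⊆ {v} ∪ ⋃ w ∈ {w ∈ H.neighborSet v | H.dist x w = H.dist x v + 1}, T w := by
      rintro u ⟨hvu, hd⟩
      obtain ⟨p, hp⟩ := hvu.exists_walk_length_eq_dist
      cases p with
      | nil => exact .inl rfl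
      | @cons _ w _ hvw q =>
        right
        rw [SimpleGraph.Walk.length_cons] at hp
        obtain ⟨q₁, hq₁⟩ := hv.exists_walk_length_eq_dist
        obtain ⟨q₂, hq₂⟩ := (hv.trans hvw.reachable).exists_walk_length_eq_dist
        have h1 := SimpleGraph.dist_le q
        have h2 := SimpleGraph.dist_le (q₁.concat hvw)
        have h3 := SimpleGraph.dist_le (q₂.append q)
        obtain ⟨q₃, hq₃⟩ := q.reachable.exists_walk_length_eq_dist
        have h4 := SimpleGraph.dist_le (q₂.append q₃)
        rw [SimpleGraph.Walk.length_concat] at h2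
        rw [SimpleGraph.Walk.length_append] at h3 h4
        simp only [Set.mem_iUnion]
        exact ⟨w, ⟨hvw, by omega⟩, q.reachable, by omega⟩
    refine Set.Finite.subset ((Set.finite_singleton v).union
      (((hfin v hv).subset (Set.sep_subset _ _)).biUnion ?_)) hsub
    rintro w ⟨h1, h2⟩
    exact hno w h1 h2
  have h0 : (T x).Infinite := hinf.mono fun v hv => ⟨hv, by simp⟩
  let A := {v // H.Reachable x v ∧ (T v).Infinite}
  choose! g hg1 hg2 hg3 using hstep
  let next : A → A := fun a =>
    ⟨g a, a.2.1.trans (hg1 a a.2.1 a.2.2).reachable, hg3 a a.2.1 a.2.2⟩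
  let f : ℕ → A := fun n => next^[n] ⟨x, .rfl, h0⟩
  have hf : ∀ n, f (n + 1) = next (f n) := fun n => Function.iterate_succ_apply' _ _ _
  have hdist : ∀ n, H.dist x (f n) = n := by
    intro n
    induction n with
    | zero => simp [f]
    | succ n ih => rw [hf]; exact (hg2 _ (f n).2.1 (f n).2.2).trans (by rw [ih])
  refine ⟨⟨fun n => f n, fun m n h => ?_, fun n => ?_⟩, rfl⟩
  · rw [← hdist m, ← hdist n]; exact congrArg _ h
  · rw [hf]; exact hg1 _ (f n).2.1 (f n).2.2

/-- If consecutive walks are such that every vertex is on only finitely many of them, then their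
union contains a ray with the same first vertex. -/
theorem exists_ray_of_walks {G : SimpleGraph V} (z : ℕ → V) (w : ∀ n, G.Walk (z n) (z (n + 1)))
    (hfin : ∀ v, {n | v ∈ (w n).support}.Finite) :
    ∃ r : Ray G, r.vert 0 = z 0 ∧ ∀ n, ∃ m, r.vert n ∈ (w m).support := by
  let H : SimpleGraph V := .fromEdgeSet {e | ∃ n, e ∈ (w n).edges}
  have hHG : H ≤ G := by
    intro a b hab
    simp only [H, SimpleGraph.fromEdgeSet_adj, Set.mem_ofPred_eq] at hab
    obtain ⟨⟨n, hn⟩, -⟩ := hab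
    exact (w n).adj_of_mem_edges hn
  have hHadj : ∀ a b, H.Adj a b → ∃ n, a ∈ (w n).support ∧ b ∈ (w n).support := by
    intro a b hab
    simp only [H, SimpleGraph.fromEdgeSet_adj, Set.mem_ofPred_eq] at hab
    obtain ⟨⟨n, hn⟩, -⟩ := hab
    exact ⟨n, (w n).fst_mem_support_of_mem_edges hn, (w n).snd_mem_support_of_mem_edges hn⟩
  have hwH : ∀ n, ∃ w' : H.Walk (z n) (z (n + 1)), True := by
    intro n
    refine ⟨(w n).transfer H fun e he => ?_, trivial⟩
    simp only [H, SimpleGraph.edgeSet_fromEdgeSet]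
    exact ⟨⟨n, he⟩, G.not_isDiag_of_mem_edgeSet ((w n).edges_subset_edgeSet he)⟩
  have hreach : ∀ n, H.Reachable (z 0) (z n) := by
    intro n
    induction n with
    | zero => exact .rfl
    | succ n ih => exact ih.trans ⟨(hwH n).choose⟩
  obtain ⟨r, hr⟩ := exists_ray_of_infinite_of_finite_neighborSet H (z 0) (by
      intro v _
      refine ((hfin v).biUnion fun n _ => (w n).support.finite_toSet).subset fun u hu => ?_
      obtain ⟨n, h1, h2⟩ := hHadj v u hu
      exact Set.mem_biUnion (show n ∈ {n | v ∈ (w n).support} from h1) h2) (by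
      refine Set.Infinite.mono (s := Set.range z) (by rintro _ ⟨n, rfl⟩; exact hreach n) ?_
      intro hf
      refine Set.infinite_univ (α := ℕ) ((hf.biUnion fun v _ => hfin v).subset fun n _ => ?_)
      exact Set.mem_biUnion ⟨n, rfl⟩ (w n).start_mem_support)
  refine ⟨⟨r.vert, r.injective, fun n => hHG (r.adj n)⟩, hr, fun n => ?_⟩
  obtain ⟨m, h, -⟩ := hHadj _ _ (r.adj n)
  exact ⟨m, h⟩

end Konig

/-! ### Boundaries of vertex sets -/

section Boundary

variable {V : Type u} {G : SimpleGraph V} {A B S : Set V}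

/-- The (inner) vertex boundary of `A`. A set `A` of vertices encodes the separation
`(A, V \ intr G A)`, whose separator is `bdry G A`. -/
def bdry (G : SimpleGraph V) (A : Set V) : Set V := {x ∈ A | ∃ y, y ∉ A ∧ G.Adj x y}

/-- The interior of `A`: the vertices of `A` all of whose neighbours are in `A`. -/
def intr (G : SimpleGraph V) (A : Set V) : Set V := {x ∈ A | ∀ y, G.Adj x y → y ∈ A}

theorem bdry_subset : bdry G A ⊆ A := fun _ h => h.1

theorem intr_subset : intr G A ⊆ A := fun _ h => h.1

theorem mem_bdry_of_mem_of_notMem_intr {x : V} (h : x ∈ A) (h' : x ∉ intr G A) :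
    x ∈ bdry G A := by
  by_contra hx
  exact h' ⟨h, fun y hy => by_contra fun hyA => hx ⟨h, y, hyA, hy⟩⟩

theorem notMem_bdry_of_mem_intr {x : V} (h : x ∈ intr G A) : x ∉ bdry G A :=
  fun ⟨_, _, hy, hxy⟩ => hy (h.2 _ hxy)

theorem notMem_intr_of_mem_bdry {x : V} (h : x ∈ bdry G A) : x ∉ intr G A :=
  fun h' => notMem_bdry_of_mem_intr h' h

theorem intr_mono (h : A ⊆ B) : intr G A ⊆ intr G B :=
  fun _ hx => ⟨h hx.1, fun y hy => h (hx.2 y hy)⟩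

theorem inter_compl_intr : A ∩ (intr G A)ᶜ = bdry G A := by
  ext x
  exact ⟨fun h => mem_bdry_of_mem_of_notMem_intr h.1 h.2,
    fun h => ⟨h.1, notMem_intr_of_mem_bdry h⟩⟩

/-- Submodularity: two sets that together cover at most what two other sets cover, with
multiplicities, are together no larger. -/
theorem encard_le_of_union_of_inter {α : Type*} {P Q R S : Set α} {k : ℕ}
    (h1 : P ∪ Q ⊆ R ∪ S) (h2 : P ∩ Q ⊆ R ∩ S) (hR : R.encard ≤ k) (hS : S.encard ≤ k)
    (hQ : (k : ℕ∞) ≤ Q.encard) : P.encard ≤ k := by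
  have h : P.encard + Q.encard ≤ R.encard + S.encard := by
    rw [← Set.encard_union_add_encard_inter, ← Set.encard_union_add_encard_inter R S]
    exact add_le_add (Set.encard_le_encard h1) (Set.encard_le_encard h2)
  have h' : P.encard + k ≤ k + k :=
    (add_le_add le_rfl hQ).trans (h.trans (add_le_add hR hS))
  exact (ENat.add_le_add_iff_right (by simp)).1 h'

theorem encard_bdry_inter_le {k : ℕ} (hA : (bdry G A).encard ≤ k) (hB : (bdry G B).encard ≤ k)
    (hAB : (k : ℕ∞) ≤ (bdry G (A ∪ B)).encard) : (bdry G (A ∩ B)).encard ≤ k := by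
  refine encard_le_of_union_of_inter ?_ ?_ hA hB hAB
  · rintro x (⟨⟨hxA, hxB⟩, y, hy, hxy⟩ | ⟨hx, y, hy, hxy⟩)
    · by_cases hyA : y ∈ A
      · exact .inr ⟨hxB, y, fun h => hy ⟨hyA, h⟩, hxy⟩
      · exact .inl ⟨hxA, y, hyA, hxy⟩
    · rcases hx with hx | hx
      · exact .inl ⟨hx, y, fun h => hy (.inl h), hxy⟩
      · exact .inr ⟨hx, y, fun h => hy (.inr h), hxy⟩
  · rintro x ⟨⟨⟨hxA, hxB⟩, -⟩, ⟨-, y, hy, hxy⟩⟩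
    exact ⟨⟨hxA, y, fun h => hy (.inl h), hxy⟩, ⟨hxB, y, fun h => hy (.inr h), hxy⟩⟩

theorem encard_bdry_sdiff_intr_le {k : ℕ} (hA : (bdry G A).encard ≤ k)
    (hB : (bdry G B).encard ≤ k) (hBA : (k : ℕ∞) ≤ (bdry G (B \ intr G A)).encard) :
    (bdry G (A \ intr G B)).encard ≤ k := by
  have key : ∀ A B : Set V, bdry G (A \ intr G B) ⊆ bdry G A ∪ bdry G B := by
    rintro A B x ⟨⟨hxA, hxB⟩, y, hy, hxy⟩
    by_cases hyA : y ∈ A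
    · have hyB : y ∈ intr G B := by_contra fun h => hy ⟨hyA, h⟩
      exact .inr (mem_bdry_of_mem_of_notMem_intr (hyB.2 x hxy.symm) hxB)
    · exact .inl ⟨hxA, y, hyA, hxy⟩
  refine encard_le_of_union_of_inter
    (Set.union_subset (key A B) ((key B A).trans (Set.union_comm _ _).subset)) ?_ hA hB hBA
  rintro x ⟨⟨⟨hxA, hxB⟩, -⟩, ⟨⟨hxB', hxA'⟩, -⟩⟩
  exact ⟨mem_bdry_of_mem_of_notMem_intr hxA hxA', mem_bdry_of_mem_of_notMem_intr hxB' hxB⟩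

theorem intr_image (φ : G ≃g G) (A : Set V) : intr G (φ '' A) = φ '' intr G A := by
  ext x
  constructor
  · rintro ⟨⟨a, ha, rfl⟩, h⟩
    refine ⟨a, ⟨ha, fun y hy => ?_⟩, rfl⟩
    obtain ⟨b, hb, h'⟩ := h (φ y) (φ.map_adj_iff.2 hy)
    rwa [← φ.injective h']
  · rintro ⟨a, ⟨ha, h⟩, rfl⟩
    refine ⟨⟨a, ha, rfl⟩, fun y hy => ⟨φ.symm y, h _ ?_, φ.apply_symm_apply y⟩⟩
    rwa [← φ.map_adj_iff, φ.apply_symm_apply]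

theorem bdry_image (φ : G ≃g G) (A : Set V) : bdry G (φ '' A) = φ '' bdry G A := by
  rw [← inter_compl_intr, ← inter_compl_intr, intr_image, Set.image_inter φ.injective,
    Set.image_compl_eq φ.bijective]

/-- In a connected graph only the empty set and the whole vertex set have empty boundary. -/
theorem eq_empty_of_bdry_eq_empty (hG : G.Connected) (h : bdry G A = ∅) {y : V} (hy : y ∉ A) :
    A = ∅ := by
  rw [Set.eq_empty_iff_forall_notMem]
  intro x hx
  obtain ⟨p⟩ := hG.preconnected x y
  obtain ⟨d, -, h1, h2⟩ := p.exists_boundary_dart A hx hy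
  have : d.fst ∈ bdry G A := ⟨h1, d.snd, h2, d.adj⟩
  simp [h] at this

/-- `S` induces a connected (or empty) subgraph: every division of `S` into two non-empty parts is
crossed by an edge. -/
def SetPreconnected (G : SimpleGraph V) (S : Set V) : Prop :=
  ∀ P : Set V, (∃ u ∈ S, u ∈ P) → (∃ v ∈ S, v ∉ P) → ∃ x ∈ S, ∃ y ∈ S, x ∈ P ∧ y ∉ P ∧ G.Adj x y

theorem SetPreconnected.subset_intr_or_disjoint (hS : SetPreconnected G S)
    (h : Disjoint S (bdry G A)) : S ⊆ intr G A ∨ Disjoint S A := by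
  by_cases h1 : ∃ u ∈ S, u ∈ A
  · left
    intro v hv
    by_contra hvA
    have hvA' : v ∉ A := fun h' =>
      Set.disjoint_left.1 h hv (mem_bdry_of_mem_of_notMem_intr h' hvA)
    obtain ⟨x, hx, y, -, hxA, hyA, hxy⟩ := hS A h1 ⟨v, hv, hvA'⟩
    exact Set.disjoint_left.1 h hx ⟨hxA, y, hyA, hxy⟩
  · right
    push Not at h1
    exact Set.disjoint_left.2 h1

theorem SetPreconnected.image (hS : SetPreconnected G S) (φ : G ≃g G) :
    SetPreconnected G (φ '' S) := by
  rintro P ⟨_, ⟨u, hu, rfl⟩, huP⟩ ⟨_, ⟨v, hv, rfl⟩, hvP⟩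
  obtain ⟨x, hx, y, hy, hxP, hyP, hxy⟩ := hS (φ ⁻¹' P) ⟨u, hu, huP⟩ ⟨v, hv, hvP⟩
  exact ⟨_, ⟨x, hx, rfl⟩, _, ⟨y, hy, rfl⟩, hxP, hyP, φ.map_adj_iff.2 hxy⟩

theorem SetPreconnected.of_walks {x : V}
    (h : ∀ v ∈ S, ∃ p : G.Walk x v, ∀ t ∈ p.support, t ∈ S) : SetPreconnected G S := by
  rintro P ⟨u, hu, huP⟩ ⟨v, hv, hvP⟩
  obtain ⟨p, hp⟩ := h u hu
  obtain ⟨q, hq⟩ := h v hv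
  obtain ⟨d, hd, h1, h2⟩ := (p.reverse.append q).exists_boundary_dart P huP hvP
  have hsub : ∀ t ∈ (p.reverse.append q).support, t ∈ S := by
    intro t ht
    rw [SimpleGraph.Walk.mem_support_append_iff, SimpleGraph.Walk.support_reverse,
      List.mem_reverse] at ht
    exact ht.elim (hp t) (hq t)
  exact ⟨d.fst, hsub _ (SimpleGraph.Walk.dart_fst_mem_support_of_mem_darts _ hd), d.snd,
    hsub _ (SimpleGraph.Walk.dart_snd_mem_support_of_mem_darts _ hd), h1, h2, d.adj⟩

theorem SetPreconnected.exists_walk (hS : SetPreconnected G S) {x y : V} (hx : x ∈ S)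
    (hy : y ∈ S) : ∃ p : G.Walk x y, ∀ t ∈ p.support, t ∈ S := by
  by_contra hno
  obtain ⟨a, ha, b, hb, ⟨p, hp⟩, hbP, hab⟩ := hS
    {v | ∃ p : G.Walk x v, ∀ t ∈ p.support, t ∈ S}
    ⟨x, hx, .nil, by simpa using hx⟩ ⟨y, hy, hno⟩
  refine hbP ⟨p.concat hab, fun t ht => ?_⟩
  rw [SimpleGraph.Walk.support_concat, List.mem_append,
    List.mem_singleton] at ht
  rcases ht with ht | rfl
  · exact hp t ht
  · exact hb

/-- A union of connected sets that all contain a common vertex is connected. -/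
theorem SetPreconnected.sUnion {𝒮 : Set (Set V)} {x : V} (h : ∀ S ∈ 𝒮, SetPreconnected G S)
    (hx : ∀ S ∈ 𝒮, x ∈ S) : SetPreconnected G (⋃₀ 𝒮) := by
  refine .of_walks (x := x) ?_
  rintro v ⟨S, hS, hv⟩
  obtain ⟨p, hp⟩ := (h S hS).exists_walk (hx S hS) hv
  exact ⟨p, fun t ht => ⟨S, hS, hp t ht⟩⟩

/-- A finite subset of a connected set is contained in a finite connected subset. -/
theorem SetPreconnected.exists_finite (hS : SetPreconnected G S) {F : Set V} (hF : F.Finite)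
    (hFS : F ⊆ S) : ∃ H : Set V, H.Finite ∧ F ⊆ H ∧ H ⊆ S ∧ SetPreconnected G H := by
  rcases F.eq_empty_or_nonempty with rfl | ⟨x, hx⟩
  · exact ⟨∅, Set.finite_empty, subset_rfl, Set.empty_subset _, by rintro P ⟨u, hu, -⟩; cases hu⟩
  have hw : ∀ v : F, ∃ p : G.Walk x v, ∀ t ∈ p.support, t ∈ S :=
    fun v => hS.exists_walk (hFS hx) (hFS v.2)
  choose p hp using hw
  have : Finite F := hF
  refine ⟨⋃ v : F, {t | t ∈ (p v).support}, Set.finite_iUnion fun v => (p v).support.finite_toSet,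
    fun v hv => Set.mem_iUnion.2 ⟨⟨v, hv⟩, (p ⟨v, hv⟩).end_mem_support⟩,
    Set.iUnion_subset fun v t ht => hp v t ht, ?_⟩
  rw [← Set.sUnion_range]
  refine .sUnion (x := x) ?_ ?_
  · classical
    rintro _ ⟨v, rfl⟩
    refine .of_walks (x := x) fun t ht => ⟨(p v).takeUntil t ht, fun s hs => ?_⟩
    exact (p v).support_takeUntil_subset_support ht hs
  · rintro _ ⟨v, rfl⟩
    exact (p v).start_mem_support

theorem setPreconnected_component {K : Set V} (C : G.ComponentCompl K) :
    SetPreconnected G (C : Set V) := by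
  rintro P ⟨u, ⟨huK, hu⟩, huP⟩ ⟨v, ⟨hvK, hv⟩, hvP⟩
  have hr : (G.induce Kᶜ).Reachable ⟨u, huK⟩ ⟨v, hvK⟩ :=
    SimpleGraph.ConnectedComponent.exact (hu.trans hv.symm)
  obtain ⟨p⟩ := hr
  have key : ∀ {a b : ↥Kᶜ} (p : (G.induce Kᶜ).Walk a b), (a : V) ∈ C → (a : V) ∈ P →
      (b : V) ∉ P → ∃ x ∈ (C : Set V), ∃ y ∈ (C : Set V), x ∈ P ∧ y ∉ P ∧ G.Adj x y := by
    intro a b p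
    induction p with
    | nil => exact fun _ h h' => absurd h h'
    | @cons a c b hac p ih =>
      intro haC haP hbP
      have hac' : G.Adj a c := hac
      have hcC : (c : V) ∈ C := SimpleGraph.ComponentCompl.mem_of_adj _ _ haC c.2 hac'
      by_cases hcP : (c : V) ∈ P
      · exact ih hcC hcP hbP
      · exact ⟨a, haC, c, hcC, haP, hcP, hac'⟩
  exact key p ⟨huK, hu⟩ huP hvP

end Boundary

/-! ### Sets without rays -/

section RayFree

variable {V : Type u} {G : SimpleGraph V} {A B S : Set V}

/-- Every ray of `G` is eventually outside `A`. When `G` has only one end and the boundary of `A`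
is finite, this says that the end lies in the complement of `A`. -/
def RayFree (G : SimpleGraph V) (A : Set V) : Prop := ∀ r : Ray G, r.LiesIn Aᶜ

theorem RayFree.mono (hB : RayFree G B) (h : A ⊆ B) : RayFree G A := fun r =>
  (hB r).imp fun _ hN n hn hA => hN n hn (h hA)

theorem RayFree.union (hA : RayFree G A) (hB : RayFree G B) : RayFree G (A ∪ B) := by
  intro r
  obtain ⟨N, hN⟩ := hA r
  obtain ⟨M, hM⟩ := hB r
  exact ⟨max N M, fun n hn => not_or.2
    ⟨hN n ((le_max_left _ _).trans hn), hM n ((le_max_right _ _).trans hn)⟩⟩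

/-- The image of a ray under an automorphism. -/
def Ray.image (r : Ray G) (φ : G ≃g G) : Ray G where
  vert n := φ (r.vert n)
  injective := φ.injective.comp r.injective
  adj n := φ.map_adj_iff.2 (r.adj n)

theorem RayFree.image (hA : RayFree G A) (φ : G ≃g G) : RayFree G (φ '' A) := by
  intro r
  obtain ⟨N, hN⟩ := hA (r.image φ.symm)
  refine ⟨N, fun n hn => ?_⟩
  rintro ⟨a, ha, h⟩
  refine hN n hn ?_
  change φ.symm (r.vert n) ∈ A
  rwa [← h, φ.symm_apply_apply]

/-- A ray that starts in the ray-free set `A` leaves it for good through a boundary vertex. -/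
theorem RayFree.exists_last (hA : RayFree G A) (r : Ray G) (h0 : r.vert 0 ∈ A) :
    ∃ n, r.vert n ∈ bdry G A ∧ ∀ m, n < m → r.vert m ∉ A := by
  classical
  have hex : ∃ N, ∀ m, N ≤ m → r.vert m ∉ A := hA r
  have hspec := Nat.find_spec hex
  have hmin := fun m => @Nat.find_min _ _ hex m
  rcases hN : Nat.find hex with _ | N
  · rw [hN] at hspec
    exact absurd h0 (hspec 0 le_rfl)
  · rw [hN] at hspec
    have h1 := hmin N (by omega)
    push Not at h1
    obtain ⟨m, hm, hmA⟩ := h1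
    have hmN : m = N := by
      by_contra hne
      exact hspec m (by omega) hmA
    subst hmN
    exact ⟨m, ⟨hmA, _, hspec _ le_rfl, r.adj m⟩, fun n hn => hspec n hn⟩

/-- There are `k` pairwise disjoint rays starting in `A`. -/
def Big (G : SimpleGraph V) (k : ℕ) (A : Set V) : Prop :=
  ∃ R : Fin k → Ray G, (∀ i, (R i).vert 0 ∈ A) ∧
    Pairwise fun i j => Disjoint (Set.range (R i).vert) (Set.range (R j).vert)

theorem Big.mono {k : ℕ} (hA : Big G k A) (h : A ⊆ B) : Big G k B := by
  obtain ⟨R, h0, hd⟩ := hA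
  exact ⟨R, fun i => h (h0 i), hd⟩

theorem Big.image {k : ℕ} (hA : Big G k A) (φ : G ≃g G) : Big G k (φ '' A) := by
  obtain ⟨R, h0, hd⟩ := hA
  refine ⟨fun i => (R i).image φ, fun i => ⟨_, h0 i, rfl⟩, fun i j hij => ?_⟩
  refine Set.disjoint_left.2 ?_
  rintro _ ⟨n, rfl⟩ ⟨m, hm⟩
  exact Set.disjoint_left.1 (hd hij) ⟨n, rfl⟩ ⟨m, φ.injective hm⟩

theorem Big.le_encard_bdry {k : ℕ} (hA : Big G k A) (hf : RayFree G A) :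
    (k : ℕ∞) ≤ (bdry G A).encard := by
  obtain ⟨R, h0, hd⟩ := hA
  choose n hn _ using fun i => hf.exists_last (R i) (h0 i)
  have hinj : Function.Injective fun i => (R i).vert (n i) := by
    intro i j h
    by_contra hij
    exact Set.disjoint_left.1 (hd hij) ⟨n i, rfl⟩ ⟨n j, h.symm⟩
  calc (k : ℕ∞) = (Set.range fun i => (R i).vert (n i)).encard := by
        rw [← Set.image_univ, hinj.encard_image, Set.encard_univ]; simp
    _ ≤ _ := Set.encard_le_encard (by rintro _ ⟨i, rfl⟩; exact hn i)

/-- Passing from `A` to the complement of the component of `G - bdry G A` that contains the end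
makes the complement connected. -/
theorem RayFree.exists_fill (hone : ∀ r r' : Ray G, r.Equivalent r') (r : Ray G)
    (hA : RayFree G A) (hfin : (bdry G A).Finite) :
    ∃ B, RayFree G B ∧ A ⊆ B ∧ bdry G B ⊆ bdry G A ∧ SetPreconnected G Bᶜ := by
  obtain ⟨C, hC⟩ := r.exists_component hfin
  have hfree : RayFree G (C : Set V)ᶜ := by
    intro r'
    obtain ⟨C', h, h'⟩ := hone r r' _ hfin
    rw [compl_compl, r.component_unique hC h]
    exact h'
  refine ⟨(C : Set V)ᶜ, hfree, ?_, ?_, by rw [compl_compl]; exact setPreconnected_component C⟩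
  · rcases (setPreconnected_component C).subset_intr_or_disjoint
      (Disjoint.symm (SimpleGraph.ComponentCompl.disjoint_right C)) with h | h
    · exfalso
      obtain ⟨N, hN⟩ := hC
      obtain ⟨M, hM⟩ := hA r
      exact hM _ (le_max_right N M) (intr_subset (h (hN _ (le_max_left N M))))
    · exact Set.subset_compl_iff_disjoint_left.2 h
  · rintro x ⟨hx, y, hy, hxy⟩
    rw [Set.notMem_compl_iff] at hy
    by_contra hxA
    exact hx (SimpleGraph.ComponentCompl.mem_of_adj y x hy hxA hxy.symm)

/-- If the complement of `A` is connected and avoids the boundary of `B`, then `B ⊆ A`. -/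
theorem RayFree.subset_of_bdry_subset (r : Ray G) (hA : RayFree G A) (hB : RayFree G B)
    (hc : SetPreconnected G Aᶜ) (h : bdry G B ⊆ A) : B ⊆ A := by
  rcases hc.subset_intr_or_disjoint (A := B)
    (Set.disjoint_left.2 fun x hx hxB => hx (h hxB)) with h' | h'
  · exfalso
    obtain ⟨N, hN⟩ := hA r
    obtain ⟨M, hM⟩ := hB r
    exact hM _ (le_max_right N M) (intr_subset (h' (hN _ (le_max_left N M))))
  · exact fun x hx => by_contra fun hxA => Set.disjoint_left.1 h' hxA hx

end RayFree

/-! ### Separators of the size of the vertex degree -/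

section Degree

variable {V : Type u} {G : SimpleGraph V} {A B : Set V}

/-- Every vertex is in the interior of a ray-free set with finite boundary. For a graph with only
one end this means that the end is undominated. -/
def FinitelySeparable (G : SimpleGraph V) : Prop :=
  ∀ x : V, ∃ A, RayFree G A ∧ (bdry G A).Finite ∧ x ∈ intr G A

theorem bdry_union_subset : bdry G (A ∪ B) ⊆ bdry G A ∪ bdry G B := by
  rintro x ⟨hx | hx, y, hy, hxy⟩
  · exact .inl ⟨hx, y, fun h => hy (.inl h), hxy⟩
  · exact .inr ⟨hx, y, fun h => hy (.inr h), hxy⟩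

theorem FinitelySeparable.exists_of_finite (h : FinitelySeparable G) {F : Set V}
    (hF : F.Finite) : ∃ A, RayFree G A ∧ (bdry G A).Finite ∧ F ⊆ intr G A := by
  induction F, hF using Set.Finite.induction_on with
  | empty =>
    exact ⟨∅, fun r => ⟨0, fun _ _ h => h⟩, Set.finite_empty.subset bdry_subset,
      Set.empty_subset _⟩
  | insert _ _ ih =>
    obtain ⟨A, hA, hA', hFA⟩ := ih
    obtain ⟨B, hB, hB', hxB⟩ := h _
    refine ⟨B ∪ A, hB.union hA, (hB'.union hA').subset bdry_union_subset,
      Set.insert_subset (intr_mono Set.subset_union_left hxB)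
        (hFA.trans (intr_mono Set.subset_union_right))⟩

/-- `A` is a ray-free set with finite boundary, and no ray-free set containing `A` has a smaller
boundary. -/
structure IsTight (G : SimpleGraph V) (A : Set V) : Prop where
  rayFree : RayFree G A
  finite : (bdry G A).Finite
  le : ∀ B, RayFree G B → A ⊆ B → (bdry G A).encard ≤ (bdry G B).encard

theorem exists_encard_bdry_le (G : SimpleGraph V) {P : Set V → Prop} (h : ∃ A, P A) :
    ∃ A, P A ∧ ∀ B, P B → (bdry G A).encard ≤ (bdry G B).encard := by
  obtain ⟨A₀, h₀⟩ := h
  obtain ⟨n, ⟨A, hA, rfl⟩, hmin⟩ := (wellFounded_lt (α := ℕ∞)).has_min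
    {n | ∃ A, P A ∧ (bdry G A).encard = n} ⟨_, A₀, h₀, rfl⟩
  exact ⟨A, hA, fun B hB => not_lt.1 (hmin _ ⟨B, hB, rfl⟩)⟩

theorem FinitelySeparable.exists_isTight_of_finite (h : FinitelySeparable G) {F : Set V}
    (hF : F.Finite) : ∃ A, IsTight G A ∧ F ⊆ A := by
  obtain ⟨A₀, h1, h2, h3⟩ := h.exists_of_finite hF
  obtain ⟨A, ⟨hA, hFA⟩, hmin⟩ := exists_encard_bdry_le G (P := fun A => RayFree G A ∧ F ⊆ A)
    ⟨A₀, h1, h3.trans intr_subset⟩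
  exact ⟨A, ⟨hA, Set.encard_lt_top_iff.1 ((hmin A₀ ⟨h1, h3.trans intr_subset⟩).trans_lt
    (Set.encard_lt_top_iff.2 h2)), fun B hB hAB => hmin B ⟨hB, hFA.trans hAB⟩⟩, hFA⟩

theorem FinitelySeparable.exists_isTight_of_isTight (h : FinitelySeparable G)
    (hA : IsTight G A) : ∃ B, IsTight G B ∧ A ⊆ intr G B := by
  obtain ⟨Z, h1, h2, h3⟩ := h.exists_of_finite hA.finite
  have hAZ : A ⊆ intr G (A ∪ Z) := by
    intro x hx
    by_cases hxA : x ∈ intr G A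
    · exact intr_mono Set.subset_union_left hxA
    · exact intr_mono Set.subset_union_right (h3 (mem_bdry_of_mem_of_notMem_intr hx hxA))
  have h4 : RayFree G (A ∪ Z) ∧ A ⊆ intr G (A ∪ Z) := ⟨hA.rayFree.union h1, hAZ⟩
  obtain ⟨B, ⟨hB, hAB⟩, hmin⟩ :=
    exists_encard_bdry_le G (P := fun B => RayFree G B ∧ A ⊆ intr G B) ⟨_, h4⟩
  exact ⟨B, ⟨hB, Set.encard_lt_top_iff.1 ((hmin _ h4).trans_lt
    (Set.encard_lt_top_iff.2 ((hA.finite.union h2).subset bdry_union_subset))),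
    fun C hC hBC => hmin C ⟨hC, hAB.trans (intr_mono hBC)⟩⟩, hAB⟩

/-- By Menger's theorem, the whole boundary of a tight set `A` is linked to the boundary of a larger
ray-free set `B` by disjoint walks that run between the two boundaries. -/
theorem IsTight.exists_walks (hA : IsTight G A) (hB : RayFree G B) (hAB : A ⊆ intr G B) :
    ∃ (σ : V → V) (w : ∀ x, G.Walk x (σ x)), ∀ x ∈ bdry G A, σ x ∈ bdry G B ∧
      (∀ v ∈ (w x).support, v ∈ B ∧ v ∉ intr G A) ∧
      ∀ y ∈ bdry G A, x ≠ y → ∀ v ∈ (w x).support, v ∉ (w y).support := by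
  classical
  obtain ⟨l, hl⟩ := ENat.ne_top_iff_exists.1 (Set.encard_ne_top_iff.2 hA.finite)
  let Q : Set V := B \ intr G A
  let H : SimpleGraph V :=
    { Adj := fun x y => G.Adj x y ∧ x ∈ Q ∧ y ∈ Q
      symm := ⟨fun _ _ h => ⟨h.1.symm, h.2.2, h.2.1⟩⟩
      loopless := ⟨fun _ h => h.1.ne rfl⟩ }
  have hHG : H ≤ G := fun _ _ h => h.1
  have hbQ : bdry G A ⊆ Q := fun x hx => ⟨(hAB hx.1).1, notMem_intr_of_mem_bdry hx⟩
  obtain ⟨a, b, p, ha, hb, hp⟩ : Linked H (bdry G A) (bdry G B) l := by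
    refine linked_of_le_encard H _ _ l fun S hS => ?_
    -- Adding to `A` what is reachable from it without meeting `S` gives a set bounded by `S`.
    let A' : Set V := A ∪ ({v | ReachAvoid H (bdry G A) S v} ∪ (S ∩ B))
    have hRQ : ∀ v, ReachAvoid H (bdry G A) S v → v ∈ Q := by
      intro v hv
      cases hv with
      | base h _ => exact hbQ h
      | step _ h _ => exact h.2.2
    have hA'B : A' ⊆ B := by
      rintro v (hv | hv | hv)
      · exact (hAB hv).1
      · exact (hRQ v hv).1
      · exact hv.2
    have hbd : bdry G A' ⊆ S := by
      rintro x ⟨hx, y, hy, hxy⟩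
      by_contra hxS
      have hyA : y ∉ A := fun h => hy (.inl h)
      have hyR : ¬ ReachAvoid H (bdry G A) S y := fun h => hy (.inr (.inl h))
      have hyS : ¬ (y ∈ S ∧ y ∈ B) := fun h => hy (.inr (.inr h))
      have hxR : ReachAvoid H (bdry G A) S x := by
        rcases hx with hx | hx | hx
        · exact .base ⟨hx, y, hyA, hxy⟩ hxS
        · exact hx
        · exact absurd hx.1 hxS
      have hyB : y ∈ B := by
        by_contra hyB
        exact hS x ⟨(hRQ x hxR).1, y, hyB, hxy⟩ hxR
      exact hyR (.step hxR ⟨hxy, hRQ x hxR, hyB, fun h => hyA h.1⟩ fun h => hyS ⟨h, hyB⟩)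
    rw [hl]
    exact (hA.le A' (hB.mono hA'B) Set.subset_union_left).trans (Set.encard_le_encard hbd)
  have hinj : Function.Injective a := by
    intro i j hij
    by_contra hne
    exact hp i j hne (a i) (p i).start_mem_support (by rw [hij]; exact (p j).start_mem_support)
  have hsurj : Set.range a = bdry G A := by
    refine hA.finite.eq_of_subset_of_encard_le' (by rintro _ ⟨i, rfl⟩; exact ha i) ?_
    rw [← hl, ← Set.image_univ, hinj.encard_image, Set.encard_univ]
    simp
  have hpQ : ∀ {x y : V} (q : H.Walk x y), x ∈ Q → ∀ v ∈ q.support, v ∈ Q := by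
    intro x y q
    induction q with
    | nil => intro hx v hv; simp only [SimpleGraph.Walk.support_nil, List.mem_singleton] at hv
             rwa [hv]
    | cons h q ih =>
      intro hx v hv
      simp only [SimpleGraph.Walk.support_cons, List.mem_cons] at hv
      rcases hv with rfl | hv
      · exact hx
      · exact ih h.2.2 v hv
  have hex : ∀ x, ∃ (y : V) (w : G.Walk x y), x ∈ bdry G A →
      ∃ i, a i = x ∧ b i = y ∧ w.support = (p i).support := by
    intro x
    by_cases hx : x ∈ bdry G A
    · rw [← hsurj] at hx
      obtain ⟨i, rfl⟩ := hx
      exact ⟨b i, (p i).mapLe hHG, fun _ => ⟨i, rfl, rfl, by simp⟩⟩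
    · exact ⟨x, .nil, fun h => absurd h hx⟩
  choose σ w hw using hex
  refine ⟨σ, w, fun x hx => ?_⟩
  obtain ⟨i, hai, hbi, hi⟩ := hw x hx
  refine ⟨hbi ▸ hb i, fun v hv => ?_, fun y hy hxy v hv hv' => ?_⟩
  · rw [hi] at hv
    exact hpQ (p i) (hbQ (ha i)) v hv
  · obtain ⟨j, haj, -, hj⟩ := hw y hy
    rw [hi] at hv
    rw [hj] at hv'
    exact hp i j (fun h => hxy (by rw [← hai, ← haj, h])) v hv hv'

/-- The boundary of a tight set is linked to the end by disjoint rays: concatenate the walks between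
the boundaries of consecutive members of an increasing sequence of tight sets. -/
theorem FinitelySeparable.exists_rays_of_isTight (h : FinitelySeparable G) (hA : IsTight G A) :
    ∃ R : bdry G A → Ray G,
      Pairwise fun i j => Disjoint (Set.range (R i).vert) (Set.range (R j).vert) := by
  let T := {A : Set V // IsTight G A}
  have hnext : ∀ A : T, ∃ B : T, A.1 ⊆ intr G B.1 := by
    rintro ⟨A, hA⟩
    obtain ⟨B, hB, hAB⟩ := h.exists_isTight_of_isTight hA
    exact ⟨⟨B, hB⟩, hAB⟩
  choose next hnext using hnext
  let s : ℕ → T := fun n => next^[n] ⟨A, hA⟩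
  have hs : ∀ n, (s n).1 ⊆ intr G (s (n + 1)).1 := by
    intro n
    simp only [s, Function.iterate_succ_apply']
    exact hnext _
  have hmono : Monotone fun n => (s n).1 := monotone_nat_of_le_succ fun n => (hs n).trans intr_subset
  have hlt : ∀ m n, m < n → (s m).1 ⊆ intr G (s n).1 := fun m n hmn =>
    (hs m).trans (intr_mono (hmono (show m + 1 ≤ n from hmn)))
  choose σ w hw using fun n => (s n).2.exists_walks (s (n + 1)).2.rayFree (hs n)
  let z : bdry G A → ℕ → V := fun x n => Nat.rec x.1 (fun n y => σ n y) n
  have hz : ∀ x n, z x n ∈ bdry G (s n).1 := by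
    intro x n
    induction n with
    | zero => exact x.2
    | succ n ih => exact (hw n _ ih).1
  have hzinj : ∀ x y, x ≠ y → ∀ n, z x n ≠ z y n := by
    intro x y hxy n
    induction n with
    | zero => exact fun h => hxy (Subtype.ext h)
    | succ n ih =>
      intro heq
      exact (hw n _ (hz x n)).2.2 _ (hz y n) ih (σ n (z x n)) (w n _).end_mem_support
        (by change σ n (z x n) = σ n (z y n) at heq; rw [heq]; exact (w n _).end_mem_support)
  -- The walks of level `m` are inside `s (m + 1)` and those of level `n` outside the interior of
  -- `s n`, so that walks of non-consecutive levels are disjoint.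
  have hle : ∀ x y m n v, v ∈ (w m (z x m)).support → v ∈ (w n (z y n)).support → n ≤ m + 1 := by
    intro x y m n v hm hn
    by_contra hlt'
    refine ((hw n _ (hz y n)).2.1 v hn).2 ?_
    exact hlt (m + 1) n (by omega) ((hw m _ (hz x m)).2.1 v hm).1
  have hray := fun x => exists_ray_of_walks (z x) (fun n => w n (z x n)) (fun v => by
    by_cases hv : ∃ m, v ∈ (w m (z x m)).support
    · obtain ⟨m, hm⟩ := hv
      exact (Set.finite_Iic (m + 1)).subset fun n hn => hle x x m n v hm hn
    · push Not at hv
      exact Set.finite_empty.subset fun n hn => hv n hn)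
  choose R _ hR using hray
  refine ⟨R, fun x y hxy => Set.disjoint_left.2 ?_⟩
  have key : ∀ x y, x ≠ y → ∀ m n v, m < n → v ∈ (w m (z x m)).support →
      v ∉ (w n (z y n)).support := by
    intro x y hxy m n v hmn hm hn
    obtain rfl : n = m + 1 := le_antisymm (hle x y m n v hm hn) hmn
    have hv := (hw _ _ (hz y _)).2.1 v hn
    have hvb : v ∈ bdry G (s (m + 1)).1 :=
      mem_bdry_of_mem_of_notMem_intr ((hw m _ (hz x m)).2.1 v hm).1 hv.2
    -- A walk of level `m + 1` contains just one vertex of `bdry (s (m + 1))`: its first one.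
    have hvz : v = z y (m + 1) := by
      by_contra hne
      exact (hw _ _ hvb).2.2 _ (hz y _) hne v (w _ v).start_mem_support hn
    refine (hw m _ (hz x m)).2.2 _ (hz y m) (hzinj x y hxy m) v hm ?_
    rw [hvz]
    exact (w m (z y m)).end_mem_support
  rintro v ⟨i, rfl⟩ ⟨j, hj⟩
  obtain ⟨m, hm⟩ := hR x i
  obtain ⟨n, hn⟩ := hR y j
  rw [hj] at hn
  rcases lt_trichotomy m n with hmn | rfl | hmn
  · exact key x y hxy m n _ hmn hm hn
  · exact (hw m _ (hz x m)).2.2 _ (hz y m) (hzinj x y hxy m) _ hm hn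
  · exact key y x hxy.symm n m _ hmn hn hm

/-- If there are at most `k` disjoint rays, then every finite set is in the interior of a ray-free
set with at most `k` boundary vertices and connected complement. -/
theorem FinitelySeparable.exists_encard_le (h : FinitelySeparable G)
    (hone : ∀ r r' : Ray G, r.Equivalent r') (r : Ray G) {k : ℕ}
    (hk : ∀ n, (∃ R : Fin n → Ray G,
      Pairwise fun i j => Disjoint (Set.range (R i).vert) (Set.range (R j).vert)) → n ≤ k)
    {F : Set V} (hF : F.Finite) :
    ∃ A, RayFree G A ∧ (bdry G A).encard ≤ k ∧ F ⊆ intr G A ∧ SetPreconnected G Aᶜ := by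
  obtain ⟨Z, hZ, hZfin, hFZ⟩ := h.exists_of_finite hF
  obtain ⟨A, hA, hZA⟩ := h.exists_isTight_of_finite hZfin
  obtain ⟨B, hB, hAB, hBb, hBc⟩ := hA.rayFree.exists_fill hone r hA.finite
  refine ⟨B, hB, ?_, ?_, hBc⟩
  · refine (Set.encard_le_encard hBb).trans ?_
    obtain ⟨R, hR⟩ := h.exists_rays_of_isTight hA
    obtain ⟨l, hl⟩ := ENat.ne_top_iff_exists.1 (Set.encard_ne_top_iff.2 hA.finite)
    rw [← hl]
    have hcard : hA.finite.toFinset.card = l := by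
      rw [hA.finite.encard_eq_coe_toFinset_card] at hl
      exact_mod_cast hl.symm
    let e := (hA.finite.toFinset.equivFinOfCardEq hcard).symm
    refine Nat.cast_le.2 (hk l
      ⟨fun i => R ⟨e i, hA.finite.mem_toFinset.1 (e i).2⟩, fun i j hij => hR fun h => hij ?_⟩)
    exact e.injective (Subtype.ext (congrArg (fun x : bdry G A => (x : V)) h))
  · exact hFZ.trans (intr_mono (hB.subset_of_bdry_subset r hZ hBc (hZA.trans hAB)))

end Degree

/-! ### Automorphisms do not shift ray-free sets -/

section Shift

variable {V : Type u} {G : SimpleGraph V} {A B : Set V} {k : ℕ}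

theorem Ray.exists_walk_segment (r : Ray G) (m : ℕ) : ∀ n, m ≤ n →
    ∃ p : G.Walk (r.vert n) (r.vert m), ∀ v ∈ p.support, ∃ j, m ≤ j ∧ j ≤ n ∧ v = r.vert j := by
  intro n hn
  induction n, hn using Nat.le_induction with
  | base => exact ⟨.nil, by simpa using ⟨m, le_rfl, le_rfl, rfl⟩⟩
  | succ n hn ih =>
    obtain ⟨p, hp⟩ := ih
    refine ⟨.cons (r.adj n).symm p, fun v hv => ?_⟩
    simp only [SimpleGraph.Walk.support_cons, List.mem_cons] at hv
    rcases hv with rfl | hv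
    · exact ⟨n + 1, by omega, le_rfl, rfl⟩
    · obtain ⟨j, h1, h2, h3⟩ := hp v hv
      exact ⟨j, h1, by omega, h3⟩

/-- When `k` disjoint rays start in a ray-free set with at most `k` boundary vertices, each of them
contains exactly one boundary vertex, its last vertex in the set. -/
theorem RayFree.exists_exit (hA : RayFree G A) (hle : (bdry G A).encard ≤ k) {R : Fin k → Ray G}
    (h0 : ∀ i, (R i).vert 0 ∈ A)
    (hd : Pairwise fun i j => Disjoint (Set.range (R i).vert) (Set.range (R j).vert)) :
    ∃ e : Fin k → ℕ, (∀ i m, (R i).vert m ∈ A ↔ m ≤ e i) ∧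
      bdry G A = Set.range fun i => (R i).vert (e i) := by
  choose e he heA using fun i => hA.exists_last (R i) (h0 i)
  have hinj : Function.Injective fun i => (R i).vert (e i) := by
    intro i j h
    by_contra hij
    exact Set.disjoint_left.1 (hd hij) ⟨e i, rfl⟩ ⟨e j, h.symm⟩
  have hfin : (bdry G A).Finite :=
    Set.encard_lt_top_iff.1 (hle.trans_lt (ENat.natCast_lt_top k))
  have heq : (Set.range fun i => (R i).vert (e i)) = bdry G A := by
    refine hfin.eq_of_subset_of_encard_le' (by rintro _ ⟨i, rfl⟩; exact he i) (hle.trans ?_)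
    rw [← Set.image_univ, hinj.encard_image, Set.encard_univ]
    simp
  refine ⟨e, fun i m => ⟨fun h => not_lt.1 fun h' => heA i m h' h, ?_⟩, heq.symm⟩
  induction m with
  | zero => exact fun _ => h0 i
  | succ m ih =>
    intro hm
    by_contra hmA
    have hb : (R i).vert m ∈ bdry G A := ⟨ih (by omega), _, hmA, (R i).adj m⟩
    rw [← heq] at hb
    obtain ⟨j, hj⟩ := hb
    by_cases hij : j = i
    · subst hij
      have := (R j).injective hj
      omega
    · exact Set.disjoint_left.1 (hd hij) ⟨_, rfl⟩ ⟨_, hj.symm⟩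

/-- A ray-free set `B` is not shifted along a ray `r` by an automorphism `θ` with `B ⊆ θ B`:
otherwise the images under the powers of `θ⁻¹` of the segment of `r` between the two boundaries
form a ray inside `θ B`. -/
theorem RayFree.exit_eq (hB : RayFree G B) (θ : G ≃g G) (hBθ : B ⊆ θ '' B) (r : Ray G) {e e' : ℕ}
    (he : ∀ m, r.vert m ∈ B ↔ m ≤ e) (he' : ∀ m, r.vert m ∈ θ '' B ↔ m ≤ e')
    (hz : r.vert e' = θ (r.vert e))
    (hu : ∀ c m : ℕ, r.vert m ∈ bdry G (⇑(θ ^ c) '' B) → r.vert (m + 1) ∉ ⇑(θ ^ c) '' B) :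
    e = e' := by
  by_contra hne
  have hee : e < e' := lt_of_le_of_ne ((he' e).1 (hBθ ((he e).2 le_rfl))) hne
  obtain ⟨p, hp⟩ := r.exists_walk_segment e e' hee.le
  have hψθ : ∀ x, θ⁻¹ (θ x) = x := θ.symm_apply_apply
  have hstep : ∀ c : ℕ, ((θ⁻¹ ^ c : G ≃g G)) (r.vert e) = (θ⁻¹ ^ (c + 1) : G ≃g G) (r.vert e') := by
    intro c
    rw [pow_succ, RelIso.mul_apply, hz, hψθ]
  have hanti : ∀ a b : ℕ, a ≤ b → ⇑(θ⁻¹ ^ b : G ≃g G) '' B ⊆ ⇑(θ⁻¹ ^ a : G ≃g G) '' B := by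
    intro a b hab
    induction b, hab using Nat.le_induction with
    | base => exact subset_rfl
    | succ b _ ih =>
      refine Set.Subset.trans ?_ ih
      rintro _ ⟨x, hx, rfl⟩
      obtain ⟨y, hy, rfl⟩ := hBθ hx
      exact ⟨y, hy, by rw [pow_succ, RelIso.mul_apply, hψθ]⟩
  have hmono : ∀ c : ℕ, 1 ≤ c → ⇑θ '' B ⊆ ⇑(θ ^ c) '' B := by
    intro c hc
    induction c, hc using Nat.le_induction with
    | base => rw [pow_one]
    | succ c _ ih =>
      refine ih.trans ?_
      rintro _ ⟨x, hx, rfl⟩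
      obtain ⟨y, hy, rfl⟩ := hBθ hx
      exact ⟨y, hy, by rw [pow_succ, RelIso.mul_apply]⟩
  let w : ∀ c : ℕ, G.Walk ((θ⁻¹ ^ c : G ≃g G) (r.vert e'))
      ((θ⁻¹ ^ (c + 1) : G ≃g G) (r.vert e')) :=
    fun c => (p.map (θ⁻¹ ^ c : G ≃g G).toHom).copy rfl (hstep c)
  have hw : ∀ c, ∀ v ∈ (w c).support, ∃ j, e ≤ j ∧ j ≤ e' ∧ v = (θ⁻¹ ^ c : G ≃g G) (r.vert j) := by
    intro c v hv
    simp only [w, SimpleGraph.Walk.support_copy, SimpleGraph.Walk.support_map, List.mem_map] at hv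
    obtain ⟨u, hu, rfl⟩ := hv
    obtain ⟨j, h1, h2, rfl⟩ := hp u hu
    exact ⟨j, h1, h2, rfl⟩
  -- Two of the walks meet at most in the last vertex of the first one.
  have hmeet : ∀ a b v, a < b → v ∈ (w a).support → v ∈ (w b).support →
      v = (θ⁻¹ ^ a : G ≃g G) (r.vert e) := by
    intro a b v hab ha hb
    obtain ⟨i, hi1, -, rfl⟩ := hw a _ ha
    obtain ⟨j, -, hj2, hj⟩ := hw b _ hb
    obtain ⟨y, hy, hyj⟩ := (he' j).2 hj2
    obtain ⟨c, rfl⟩ : ∃ c, b = c + 1 := ⟨b - 1, by omega⟩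
    rw [← hyj, pow_succ, RelIso.mul_apply, hψθ] at hj
    obtain ⟨x, hx, hxi⟩ := hanti a c (by omega) ⟨y, hy, hj.symm⟩
    have : x = r.vert i := (θ⁻¹ ^ a : G ≃g G).injective hxi
    rw [this, he] at hx
    rw [le_antisymm hx hi1]
  have hfin : ∀ v, {c | v ∈ (w c).support}.Finite := by
    intro v
    by_contra hinf
    have hinf : {c | v ∈ (w c).support}.Infinite := hinf
    obtain ⟨a, ha⟩ := hinf.nonempty
    obtain ⟨b, hb, hab⟩ := hinf.exists_gt a
    obtain ⟨c, hc, hbc⟩ := hinf.exists_gt b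
    have h1 := hmeet a b v hab ha hb
    have h2 := hmeet b c v hbc hb hc
    obtain ⟨d, rfl⟩ : ∃ d, b = a + d := ⟨b - a, by omega⟩
    rw [h1, pow_add, RelIso.mul_apply] at h2
    have h3 : r.vert e = (θ⁻¹ ^ d : G ≃g G) (r.vert e) := (θ⁻¹ ^ a : G ≃g G).injective h2
    have h4 : (θ ^ d : G ≃g G) (r.vert e) = r.vert e := by
      conv_lhs => rw [h3, ← RelIso.mul_apply, inv_pow, mul_inv_cancel, RelIso.one_apply]
    -- So `r.vert e` is fixed by `θ ^ d`, hence a boundary vertex of `θ ^ d B`, although `r` stays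
    -- in that set beyond it.
    have h5 : r.vert e ∈ bdry G B :=
      ⟨(he e).2 le_rfl, r.vert (e + 1), fun h => by have := (he _).1 h; omega, r.adj e⟩
    have h6 : r.vert e ∈ bdry G (⇑(θ ^ d) '' B) := by
      rw [bdry_image]
      exact ⟨_, h5, h4⟩
    exact hu d e h6 (hmono d (by omega) ((he' (e + 1)).2 hee))
  obtain ⟨r', -, hr'⟩ := exists_ray_of_walks _ w hfin
  obtain ⟨N, hN⟩ := hB.image θ r'
  apply hN N le_rfl
  obtain ⟨c, hc⟩ := hr' N
  obtain ⟨j, -, hj, hv⟩ := hw c _ hc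
  rw [hv]
  have h1 : ∀ c : ℕ, ⇑(θ⁻¹ ^ c : G ≃g G) '' (⇑θ '' B) ⊆ ⇑θ '' B := by
    intro c
    rw [Set.image_subset_iff]
    rintro _ ⟨y, hy, rfl⟩
    rw [Set.mem_preimage, ← RelIso.mul_apply]
    rcases c with _ | c
    · exact ⟨y, hy, rfl⟩
    · refine hBθ ?_
      obtain ⟨x, hx, h⟩ := hanti 0 c (by omega) ⟨y, hy, rfl⟩
      rw [pow_succ, RelIso.mul_apply, RelIso.mul_apply, hψθ, ← h]
      exact hx
  exact h1 c ⟨_, (he' j).2 hj, rfl⟩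

/-- If `A` is ray-free, `k` disjoint rays start in `A`, and `A` has at most `k` boundary vertices,
then an automorphism that enlarges `A` fixes its boundary. -/
theorem RayFree.bdry_eq_of_subset_image (hA : RayFree G A) (hbig : Big G k A)
    (hle : (bdry G A).encard ≤ k) (φ : G ≃g G) (hφ : A ⊆ φ '' A) :
    bdry G A = bdry G (φ '' A) := by
  obtain ⟨R, h0, hd⟩ := hbig
  let B : ℕ → Set V := fun n => ⇑(φ ^ n) '' A
  have hBsucc : ∀ n, B n ⊆ B (n + 1) := by
    rintro n _ ⟨x, hx, rfl⟩
    obtain ⟨y, hy, rfl⟩ := hφ hx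
    exact ⟨y, hy, by rw [pow_succ, RelIso.mul_apply]⟩
  have hmono : Monotone B := monotone_nat_of_le_succ hBsucc
  have hB0 : B 0 = A := by simp [B]
  have hBfree : ∀ n, RayFree G (B n) := fun n => hA.image _
  have hBb : ∀ n, bdry G (B n) = ⇑(φ ^ n) '' bdry G A := fun n => bdry_image _ _
  have hBle : ∀ n, (bdry G (B n)).encard ≤ k := fun n => by
    rw [hBb, (φ ^ n).injective.encard_image]; exact hle
  have hB0i : ∀ n i, (R i).vert 0 ∈ B n := fun n i =>
    hmono (Nat.zero_le n) (by rw [hB0]; exact h0 i)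
  choose e he heb using fun n => (hBfree n).exists_exit (hBle n) (hB0i n) hd
  have hemono : ∀ i, Monotone fun n => e n i := fun i m n hmn =>
    (he n i _).1 (hmono hmn ((he m i _).2 le_rfl))
  have hexit : ∀ n i m, (R i).vert m ∈ bdry G (B n) → (R i).vert (m + 1) ∉ B n := by
    intro n i m hm h
    rw [heb n] at hm
    obtain ⟨j, hj⟩ := hm
    by_cases hij : j = i
    · subst hij
      have h1 := (R j).injective hj
      have h2 := (he n j _).1 h
      omega
    · exact Set.disjoint_left.1 (hd hij) ⟨_, rfl⟩ ⟨_, hj.symm⟩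
  have heb' : ∀ n i, (R i).vert (e n i) ∈ bdry G (B n) := fun n i => by
    rw [heb n]; exact ⟨i, rfl⟩
  have hfinA : Finite (bdry G A) := Set.encard_lt_top_iff.1 (hle.trans_lt (ENat.natCast_lt_top k))
  have hpull : ∀ n i, ∃ x : bdry G A, (φ ^ n) x.1 = (R i).vert (e n i) := by
    intro n i
    have := heb' n i
    rw [hBb] at this
    obtain ⟨x, hx, h⟩ := this
    exact ⟨⟨x, hx⟩, h⟩
  choose ν hν using hpull
  -- Exits in the same position relative to `A` coincide.
  have hsame : ∀ i m n, m < n → ν m i = ν n i → e m i = e n i := by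
    intro i m n hmn hmn'
    obtain ⟨d, rfl⟩ : ∃ d, n = m + d := ⟨n - m, by omega⟩
    have hBmul : ∀ c : ℕ, ⇑((φ ^ d) ^ c) '' B m = B (m + d * c) := by
      intro c
      rw [← pow_mul]
      simp only [B, Set.image_image, ← RelIso.mul_apply, ← pow_add]
      rw [add_comm]
    have hB1 : ⇑(φ ^ d) '' B m = B (m + d) := by simpa using hBmul 1
    refine (hBfree m).exit_eq (φ ^ d) (by rw [hB1]; exact hmono (by omega)) (R i) (he m i)
      (by rw [hB1]; exact he _ i) ?_ ?_
    · rw [← hν, ← hν, hmn', ← RelIso.mul_apply, ← pow_add, add_comm m d]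
    · intro c j
      rw [hBmul]
      exact hexit _ i j
  -- By the pigeonhole principle and monotonicity, every ray has the same exit from almost all `B n`.
  have hconst : ∀ i, ∃ N, ∀ n, N ≤ n → e n i = e N i := by
    intro i
    obtain ⟨y, hy⟩ := Finite.exists_infinite_fiber fun n => ν n i
    have hy : ((fun n => ν n i) ⁻¹' {y}).Infinite := Set.infinite_coe_iff.1 hy
    obtain ⟨N, hN⟩ := hy.nonempty
    refine ⟨N, fun n hn => ?_⟩
    obtain ⟨n', hn', hnn'⟩ := hy.exists_gt n
    have h1 := hsame i N n' (by omega) (hN.trans hn'.symm)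
    exact le_antisymm (h1 ▸ hemono i hnn'.le) (hemono i hn)
  choose N hN using hconst
  let M := Finset.univ.sup N
  have hM : ∀ i, e (M + 1) i = e M i := by
    intro i
    have : N i ≤ M := Finset.le_sup (Finset.mem_univ i)
    rw [hN i _ this, hN i _ (this.trans (Nat.le_succ M))]
  have h1 : bdry G (B M) = bdry G (B (M + 1)) := by
    rw [heb, heb]
    simp only [hM]
  rw [hBb, hBb, pow_succ] at h1
  rw [bdry_image]
  apply (φ ^ M).injective.image_injective
  rw [h1, Set.image_image]
  rfl

end Shift

/-! ### Exhaustions and their translates -/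

section Exhaustion

variable {V : Type u} {G : SimpleGraph V} {k : ℕ}

/-- An exhaustion of `G` by ray-free sets `A n` with at most `k` boundary vertices, each containing
the starting vertices of `k` disjoint rays. The boundary of `A n` is contained in a connected set
`H n` that lies between `A n` and `A (n + 1)`. -/
structure Exhaustion (G : SimpleGraph V) (k : ℕ) where
  /-- The ray-free sets. -/
  A : ℕ → Set V
  /-- The connected sets between consecutive members. -/
  H : ℕ → Set V
  rayFree : ∀ n, RayFree G (A n)
  encard_le : ∀ n, (bdry G (A n)).encard ≤ k
  big : ∀ n, Big G k (A n)
  bdry_subset_H : ∀ n, bdry G (A n) ⊆ H n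
  preconnected_H : ∀ n, SetPreconnected G (H n)
  disjoint_H : ∀ n, Disjoint (H n) (intr G (A n))
  A_subset : ∀ n, A n ⊆ intr G (A (n + 1))
  H_subset : ∀ n, H n ⊆ intr G (A (n + 1))
  exists_mem : ∀ x, ∃ n, x ∈ A n

theorem setPreconnected_compl_intr {A : Set V} {c : V} (hc : c ∉ A)
    (h : SetPreconnected G Aᶜ) : SetPreconnected G (intr G A)ᶜ := by
  refine .of_walks (x := c) fun v hv => ?_
  by_cases hvA : v ∈ A
  · obtain ⟨-, y, hy, hvy⟩ := mem_bdry_of_mem_of_notMem_intr hvA hv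
    obtain ⟨p, hp⟩ := h.exists_walk hc hy
    refine ⟨p.concat hvy.symm, fun t ht => ?_⟩
    rw [SimpleGraph.Walk.support_concat, List.mem_append, List.mem_singleton] at ht
    rcases ht with ht | rfl
    · exact fun h' => hp t ht h'.1
    · exact hv
  · obtain ⟨p, hp⟩ := h.exists_walk hc hvA
    exact ⟨p, fun t ht h' => hp t ht h'.1⟩

theorem FinitelySeparable.exists_exhaustion (h : FinitelySeparable G) (hG : G.Connected)
    (hone : ∀ r r' : Ray G, r.Equivalent r') (r : Ray G)
    (hk : ∀ n, (∃ R : Fin n → Ray G,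
      Pairwise fun i j => Disjoint (Set.range (R i).vert) (Set.range (R j).vert)) → n ≤ k)
    (hR : ∃ R : Fin k → Ray G,
      Pairwise fun i j => Disjoint (Set.range (R i).vert) (Set.range (R j).vert)) :
    Nonempty (Exhaustion G k) := by
  let T := {A : Set V // RayFree G A ∧ (bdry G A).encard ≤ k ∧ SetPreconnected G Aᶜ}
  obtain ⟨R, hR⟩ := hR
  obtain ⟨A₀, h1, h2, h3, h4⟩ := h.exists_encard_le hone r hk
    ((Set.finite_singleton (r.vert 0)).union (Set.finite_range fun i => (R i).vert 0))
  have hstep : ∀ A : T, ∃ (B : T) (H : Set V), bdry G A.1 ⊆ H ∧ SetPreconnected G H ∧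
      Disjoint H (intr G A.1) ∧ A.1 ⊆ intr G B.1 ∧ H ⊆ intr G B.1 := by
    rintro ⟨A, hA1, hA2, hA3⟩
    obtain ⟨N, hN⟩ := hA1 r
    obtain ⟨H, hHf, hAH, hHA, hHc⟩ := (setPreconnected_compl_intr (hN N le_rfl) hA3).exists_finite
      (Set.encard_lt_top_iff.1 (hA2.trans_lt (ENat.natCast_lt_top k)))
      (fun x hx => notMem_intr_of_mem_bdry hx)
    obtain ⟨B, hB1, hB2, hB3, hB4⟩ := h.exists_encard_le hone r hk hHf
    have hAB : A ⊆ B := hB1.subset_of_bdry_subset r hA1 hB4 ((hAH.trans hB3).trans intr_subset)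
    refine ⟨⟨B, hB1, hB2, hB4⟩, H, hAH, hHc, Set.subset_compl_iff_disjoint_right.1 hHA, ?_, hB3⟩
    intro x hx
    by_cases hxA : x ∈ intr G A
    · exact intr_mono hAB hxA
    · exact hB3 (hAH (mem_bdry_of_mem_of_notMem_intr hx hxA))
  choose next H hH1 hH2 hH3 hH4 hH5 using hstep
  let s : ℕ → T := fun n => next^[n] ⟨A₀, h1, h2, h4⟩
  have hs : ∀ n, s (n + 1) = next (s n) := fun n => Function.iterate_succ_apply' _ _ _
  have hsub : ∀ n, (s n).1 ⊆ intr G (s (n + 1)).1 := fun n => by rw [hs]; exact hH4 _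
  have hmono : Monotone fun n => (s n).1 :=
    monotone_nat_of_le_succ fun n => (hsub n).trans intr_subset
  have hbig : Big G k (s 0).1 :=
    ⟨R, fun i => intr_subset (h3 (.inr ⟨i, rfl⟩)), hR⟩
  refine ⟨⟨fun n => (s n).1, fun n => H (s n), fun n => (s n).2.1, fun n => (s n).2.2.1,
    fun n => hbig.mono (hmono (Nat.zero_le n)), fun n => hH1 _, fun n => hH2 _, fun n => hH3 _,
    hsub, fun n => by rw [hs]; exact hH5 _, fun x => ?_⟩⟩
  by_contra hx
  obtain ⟨p⟩ := hG.preconnected (r.vert 0) x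
  obtain ⟨d, -, ⟨n, hn⟩, hd⟩ := p.exists_boundary_dart {v | ∃ n, v ∈ (s n).1}
    ⟨0, intr_subset (h3 (.inl rfl))⟩ hx
  exact hd ⟨n + 1, (hsub n hn).2 _ d.adj⟩

namespace Exhaustion

variable (E : Exhaustion G k)

theorem monotone : Monotone E.A :=
  monotone_nat_of_le_succ fun n => (E.A_subset n).trans intr_subset

theorem H_subset_intr {m n : ℕ} (h : m < n) : E.H m ⊆ intr G (E.A n) :=
  (E.H_subset m).trans (intr_mono (E.monotone h))

theorem disjoint_H_H {m n : ℕ} (h : m < n) : Disjoint (E.H m) (E.H n) :=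
  ((E.disjoint_H n).mono_right (E.H_subset_intr h)).symm

theorem bdry_nonempty (hk : 0 < k) (n : ℕ) : (bdry G (E.A n)).Nonempty := by
  rw [← Set.encard_pos]
  exact lt_of_lt_of_le (by exact_mod_cast hk) ((E.big n).le_encard_bdry (E.rayFree n))

/-- No translate of the interior of `A 0` meets the boundary of `A n` when `n > k`. Otherwise the
boundary of `A n`, having at most `k` vertices, misses one of the `k` disjoint connected sets
`φ (H i)`, `i < k`. Then `φ (A i)` can be added to `A n` or removed from it so that the boundary
becomes too small. -/
theorem disjoint_image_intr_bdry (hG : G.Connected) (φ : G ≃g G) {n : ℕ} (hn : k < n) :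
    Disjoint (φ '' intr G (E.A 0)) (bdry G (E.A n)) := by
  rw [Set.disjoint_left]
  rintro _ ⟨x, hx, rfl⟩ hxn
  -- Otherwise `φ x` and a point of each `φ (H i)` would be `k + 1` boundary vertices of `A n`.
  obtain ⟨i, hik, hi⟩ : ∃ i, i < k ∧ Disjoint (φ '' E.H i) (bdry G (E.A n)) := by
    by_contra hno
    have hex : ∀ i : Fin k, ∃ y ∈ E.H i, φ y ∈ bdry G (E.A n) := by
      intro i
      obtain ⟨_, ⟨y, hy, rfl⟩, hy'⟩ := Set.not_disjoint_iff.1 fun h => hno ⟨i, i.2, h⟩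
      exact ⟨y, hy, hy'⟩
    choose y hyH hyb using hex
    have hinj : Function.Injective fun i => φ (y i) := by
      intro i j hij
      by_contra hne
      have hij : y i = y j := φ.injective hij
      rcases lt_or_gt_of_ne (Fin.val_injective.ne hne) with h | h
      · exact Set.disjoint_left.1 (E.disjoint_H_H h) (hyH i) (hij ▸ hyH j)
      · exact Set.disjoint_left.1 (E.disjoint_H_H h) (hyH j) (hij ▸ hyH i)
    have hxy : φ x ∉ Set.range fun i => φ (y i) := by
      rintro ⟨i, hi⟩
      have hi : y i = x := φ.injective hi
      exact Set.disjoint_left.1 (E.disjoint_H i) (hyH i)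
        (intr_mono (E.monotone (Nat.zero_le _)) (hi ▸ hx))
    have hcard : (insert (φ x) (Set.range fun i => φ (y i))).encard = k + 1 := by
      rw [Set.encard_insert_of_notMem hxy, ← Set.image_univ, hinj.encard_image, Set.encard_univ]
      simp
    have hsub : Set.range (fun i => φ (y i)) ⊆ bdry G (E.A n) := by
      rintro _ ⟨i, rfl⟩
      exact hyb i
    have hle := (Set.encard_le_encard (Set.insert_subset hxn hsub)).trans (E.encard_le n)
    rw [hcard] at hle
    exact absurd (by exact_mod_cast hle) (Nat.not_succ_le_self k)
  have hkpos : 0 < k := by omega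
  set N := φ '' E.A i with hN
  have hNb : bdry G N ⊆ φ '' E.H i := by
    rw [hN, bdry_image]
    exact Set.image_mono (E.bdry_subset_H i)
  have hxN : φ x ∈ intr G N := by
    rw [hN, intr_image]
    exact ⟨x, intr_mono (E.monotone (Nat.zero_le i)) hx, rfl⟩
  have hsmall : ∀ B : Set V, bdry G B ⊆ bdry G (E.A n) \ {φ x} → Big G k B → RayFree G B →
      False := by
    intro B hB hbig hfree
    have h1 := (hbig.le_encard_bdry hfree).trans (Set.encard_le_encard hB)
    have h2 := Set.encard_sdiff_singleton_add_one hxn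
    have h3 := E.encard_le n
    rw [← h2] at h3
    have h4 : ((k : ℕ∞)) + 1 ≤ k := (add_le_add h1 le_rfl).trans h3
    exact absurd (by exact_mod_cast h4) (Nat.not_succ_le_self k)
  -- The boundary of `N` lies in `φ (H i)`, hence inside or outside `A n`. In the first case `φ x`
  -- is not a boundary vertex of `A n ∪ N`, in the second it is none of `A n \ N`.
  rcases ((E.preconnected_H i).image φ).subset_intr_or_disjoint hi with h | h
  · refine hsmall (E.A n ∪ N) ?_ ((E.big n).mono Set.subset_union_left)
      ((E.rayFree n).union ((E.rayFree i).image φ))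
    rintro y ⟨hy, z, hz, hyz⟩
    rcases hy with hy | hy
    · refine ⟨⟨hy, z, fun h' => hz (.inl h'), hyz⟩, ?_⟩
      rintro rfl
      exact hz (.inr (hxN.2 z hyz))
    · exact absurd (.inl ((h (hNb ⟨hy, z, fun h' => hz (.inr h'), hyz⟩)).2 z hyz)) hz
  · have hNA : ∀ z ∈ bdry G N, z ∉ E.A n := fun z hz => Set.disjoint_left.1 h (hNb hz)
    have hmn : E.A (i + 1) ⊆ E.A n := E.monotone (by omega)
    have hHN : Disjoint (E.H (i + 1)) (bdry G N) :=
      Set.disjoint_left.2 fun z hz hz' =>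
        hNA z hz' (intr_subset (E.H_subset_intr (by omega : i + 1 < n) hz))
    rcases (E.preconnected_H (i + 1)).subset_intr_or_disjoint hHN with h' | h'
    · have hempty : E.A (i + 1) \ N = ∅ := by
        refine eq_empty_of_bdry_eq_empty hG ?_ (y := φ x) (fun h => h.2 hxN.1)
        rw [Set.eq_empty_iff_forall_notMem]
        rintro y ⟨⟨hy, hyN⟩, z, hz, hyz⟩
        by_cases hzA : z ∈ E.A (i + 1)
        · have hzN : z ∈ N := by_contra fun h => hz ⟨hzA, h⟩
          exact hNA z ⟨hzN, y, hyN, hyz.symm⟩ (hmn hzA)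
        · exact hyN (intr_subset (h' (E.bdry_subset_H _ ⟨hy, z, hzA, hyz⟩)))
      -- Now `φ` maps `A i` to a set having all of `A i` in its interior, which is a shift.
      have hsub : E.A (i + 1) ⊆ N := Set.sdiff_eq_empty.1 hempty
      have heq := (E.rayFree i).bdry_eq_of_subset_image (E.big i) (E.encard_le i) φ
        ((E.monotone (Nat.le_succ i)).trans hsub)
      obtain ⟨y, hy⟩ := E.bdry_nonempty hkpos i
      refine notMem_bdry_of_mem_intr (intr_mono hsub (E.A_subset i hy.1)) ?_
      rw [← heq]
      exact hy
    · have hempty : E.A (i + 1) ∩ N = ∅ := by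
        obtain ⟨c, hc⟩ := E.bdry_nonempty hkpos (i + 1)
        refine eq_empty_of_bdry_eq_empty hG ?_ (y := c)
          (fun h => Set.disjoint_left.1 h' (E.bdry_subset_H _ hc) h.2)
        rw [Set.eq_empty_iff_forall_notMem]
        rintro y ⟨⟨hy, hyN⟩, z, hz, hyz⟩
        by_cases hzA : z ∈ E.A (i + 1)
        · exact hNA y ⟨hyN, z, fun h => hz ⟨hzA, h⟩, hyz⟩ (hmn hy)
        · exact Set.disjoint_left.1 h' (E.bdry_subset_H _ ⟨hy, z, hzA, hyz⟩) hyN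
      have hsub : E.A (i + 1) ⊆ E.A n \ N := fun y hy =>
        ⟨hmn hy, fun hyN => Set.eq_empty_iff_forall_notMem.1 hempty y ⟨hy, hyN⟩⟩
      refine hsmall (E.A n \ N) ?_ ((E.big (i + 1)).mono hsub)
        ((E.rayFree n).mono Set.sdiff_subset)
      rintro y ⟨⟨hy, hyN⟩, z, hz, hyz⟩
      by_cases hzA : z ∈ E.A n
      · have hzN : z ∈ N := by_contra fun h => hz ⟨hzA, h⟩
        exact absurd hzA (hNA z ⟨hzN, y, hyN, hyz.symm⟩)
      · refine ⟨⟨hy, z, hzA, hyz⟩, ?_⟩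
        rintro rfl
        exact hyN hxN.1

/-- The exhaustion without its first `m` members. -/
def shift (m : ℕ) : Exhaustion G k where
  A n := E.A (m + n)
  H n := E.H (m + n)
  rayFree _ := E.rayFree _
  encard_le _ := E.encard_le _
  big _ := E.big _
  bdry_subset_H _ := E.bdry_subset_H _
  preconnected_H _ := E.preconnected_H _
  disjoint_H _ := E.disjoint_H _
  A_subset _ := E.A_subset _
  H_subset _ := E.H_subset _
  exists_mem x := by
    obtain ⟨n, hn⟩ := E.exists_mem x
    exact ⟨n, E.monotone (Nat.le_add_left n m) hn⟩

theorem preconnected_union (hG : G.Connected) (n : ℕ) :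
    SetPreconnected G (E.A n ∪ E.H n) := by
  rintro P ⟨u, hu, huP⟩ ⟨v, hv, hvP⟩
  by_contra! hno
  have hH := E.preconnected_H n P
  by_cases hHP : ∃ a ∈ E.H n, a ∈ P
  · by_cases hHP' : ∃ a ∈ E.H n, a ∉ P
    · obtain ⟨x, hx, y, hy, hxP, hyP, hxy⟩ := hH hHP hHP'
      exact hno x (.inr hx) y (.inr hy) hxP hyP hxy
    · push Not at hHP'
      have hempty : E.A n \ P = ∅ := by
        refine eq_empty_of_bdry_eq_empty hG ?_ (y := u) (fun h => h.2 huP)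
        rw [Set.eq_empty_iff_forall_notMem]
        rintro x ⟨⟨hx, hxP⟩, y, hy, hxy⟩
        by_cases hyA : y ∈ E.A n
        · exact hno y (.inl hyA) x (.inl hx) (by_contra fun h => hy ⟨hyA, h⟩) hxP hxy.symm
        · exact hxP (hHP' x (E.bdry_subset_H n ⟨hx, y, hyA, hxy⟩))
      rcases hv with hv | hv
      · exact Set.eq_empty_iff_forall_notMem.1 hempty v ⟨hv, hvP⟩
      · exact hvP (hHP' v hv)
  · push Not at hHP
    have hempty : E.A n ∩ P = ∅ := by
      refine eq_empty_of_bdry_eq_empty hG ?_ (y := v) (fun h => hvP h.2)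
      rw [Set.eq_empty_iff_forall_notMem]
      rintro x ⟨⟨hx, hxP⟩, y, hy, hxy⟩
      by_cases hyA : y ∈ E.A n
      · exact hno x (.inl hx) y (.inl hyA) hxP (fun h => hy ⟨hyA, h⟩) hxy
      · exact hHP x (E.bdry_subset_H n ⟨hx, y, hyA, hxy⟩) hxP
    rcases hu with hu | hu
    · exact Set.eq_empty_iff_forall_notMem.1 hempty u ⟨hu, huP⟩
    · exact hHP u hu huP

end Exhaustion

end Exhaustion

/-! ### Nested levels of separations -/

section Levels

variable {V : Type u} {G : SimpleGraph V} {k : ℕ}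

/-- An exhaustion by ray-free sets `A n` and connected sets `W n` with
`A n ⊆ W n ⊆ intr (A (n + 1))` such that the boundary of `A n` avoids all translates of the sets
`W m` with `m < n`. -/
structure Tower (G : SimpleGraph V) (k : ℕ) where
  /-- The ray-free sets. -/
  A : ℕ → Set V
  /-- The connected sets between consecutive members. -/
  W : ℕ → Set V
  rayFree : ∀ n, RayFree G (A n)
  encard_le : ∀ n, (bdry G (A n)).encard ≤ k
  big : ∀ n, Big G k (A n)
  A_subset_W : ∀ n, A n ⊆ W n
  W_subset : ∀ n, W n ⊆ intr G (A (n + 1))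
  preconnected_W : ∀ n, SetPreconnected G (W n)
  disjoint_image : ∀ m n, m < n → ∀ φ : G ≃g G, Disjoint (φ '' W m) (bdry G (A n))
  exists_mem : ∀ x, ∃ n, x ∈ A n

/-- Every `(k + 2)`-nd member of an exhaustion forms a tower. -/
theorem Exhaustion.exists_tower (E : Exhaustion G k) (hG : G.Connected) :
    Nonempty (Tower G k) := by
  refine ⟨⟨fun n => E.A ((k + 2) * n), fun n => E.A ((k + 2) * n) ∪ E.H ((k + 2) * n),
    fun n => E.rayFree _, fun n => E.encard_le _, fun n => E.big _,
    fun n => Set.subset_union_left, fun n => ?_, fun n => E.preconnected_union hG _,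
    fun m n hmn φ => ?_, fun x => ?_⟩⟩
  · refine (Set.union_subset (E.A_subset _) (E.H_subset _)).trans (intr_mono (E.monotone ?_))
    rw [mul_add]
    omega
  · have h : (k + 2) * m + (k + 2) ≤ (k + 2) * n := by
      rw [← Nat.mul_succ]
      exact Nat.mul_le_mul_left _ hmn
    have h1 := (E.shift ((k + 2) * m + 1)).disjoint_image_intr_bdry hG φ
      (n := (k + 2) * n - ((k + 2) * m + 1)) (by omega)
    have h2 : (k + 2) * m + 1 + ((k + 2) * n - ((k + 2) * m + 1)) = (k + 2) * n := by omega
    simp only [Exhaustion.shift, h2, add_zero] at h1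
    exact h1.mono_left (Set.image_mono (Set.union_subset (E.A_subset _) (E.H_subset _)))
  · obtain ⟨n, hn⟩ := E.exists_mem x
    exact ⟨n, E.monotone (Nat.le_mul_of_pos_left n (by omega)) hn⟩

namespace Tower

variable (T : Tower G k)

theorem A_subset_intr {m n : ℕ} (h : m < n) : T.A m ⊆ intr G (T.A n) := by
  induction n, h using Nat.le_induction with
  | base => exact (T.A_subset_W m).trans (T.W_subset m)
  | succ n _ ih =>
    exact ih.trans (intr_subset.trans ((T.A_subset_W n).trans (T.W_subset n)))

/-- The union of all translates of the first `n + 1` sets `W m`. -/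
def U (n : ℕ) : Set V := {x | ∃ m ≤ n, ∃ φ : G ≃g G, x ∈ φ '' T.W m}

theorem image_U (n : ℕ) (φ : G ≃g G) : φ '' T.U n = T.U n := by
  have key : ∀ φ : G ≃g G, φ '' T.U n ⊆ T.U n := by
    rintro φ _ ⟨_, ⟨m, hm, ψ, ⟨x, hx, rfl⟩⟩, rfl⟩
    exact ⟨m, hm, φ * ψ, x, hx, rfl⟩
  refine (key φ).antisymm fun x hx => ⟨φ.symm x, key φ.symm ⟨x, hx, rfl⟩, φ.apply_symm_apply x⟩

theorem image_W_subset_U {m n : ℕ} (h : m ≤ n) (φ : G ≃g G) : φ '' T.W m ⊆ T.U n :=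
  fun _ hx => ⟨m, h, φ, hx⟩

/-- The ray-free sets containing `S` that have at most `k` boundary vertices, none of which is in
`U n`. -/
def cuts (n : ℕ) (S : Set V) : Set (Set V) :=
  {A | RayFree G A ∧ (bdry G A).encard ≤ k ∧ Disjoint (T.U n) (bdry G A) ∧ S ⊆ A}

theorem image_mem_cuts {n : ℕ} {S A : Set V} (h : A ∈ T.cuts n S) (φ : G ≃g G) :
    φ '' A ∈ T.cuts n (φ '' S) := by
  obtain ⟨h1, h2, h3, h4⟩ := h
  refine ⟨h1.image φ, ?_, ?_, Set.image_mono h4⟩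
  · rwa [bdry_image, φ.injective.encard_image]
  · rw [bdry_image, ← T.image_U n φ]
    exact (Set.disjoint_image_iff φ.injective).2 h3

theorem A_mem_cuts (n : ℕ) : T.A (n + 1) ∈ T.cuts n (T.W n) := by
  refine ⟨T.rayFree _, T.encard_le _, ?_, (T.W_subset n).trans intr_subset⟩
  rw [Set.disjoint_left]
  rintro x ⟨m, hm, φ, hx⟩ hx'
  exact Set.disjoint_left.1 (T.disjoint_image m (n + 1) (by omega) φ) hx hx'

theorem inter_mem_cuts {n : ℕ} {S A B : Set V} (hS : Big G k S) (hA : A ∈ T.cuts n S)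
    (hB : B ∈ T.cuts n S) : A ∩ B ∈ T.cuts n S := by
  obtain ⟨h1, h2, h3, h4⟩ := hA
  obtain ⟨g1, g2, g3, g4⟩ := hB
  refine ⟨h1.mono Set.inter_subset_left, encard_bdry_inter_le h2 g2
    ((hS.mono (h4.trans Set.subset_union_left)).le_encard_bdry (h1.union g1)), ?_,
    Set.subset_inter h4 g4⟩
  rw [Set.disjoint_left]
  rintro x hx ⟨⟨hxA, hxB⟩, y, hy, hxy⟩
  by_cases hyA : y ∈ A
  · exact Set.disjoint_left.1 g3 hx ⟨hxB, y, fun h => hy ⟨hyA, h⟩, hxy⟩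
  · exact Set.disjoint_left.1 h3 hx ⟨hxA, y, hyA, hxy⟩

/-- The smallest set in `T.cuts n (T.W n)`. -/
def D (n : ℕ) : Set V := ⋂₀ T.cuts n (T.W n)

theorem big_W (n : ℕ) : Big G k (T.W n) := (T.big n).mono (T.A_subset_W n)

theorem D_subset_of_mem_cuts {n : ℕ} {A : Set V} (φ : G ≃g G)
    (h : A ∈ T.cuts n (φ '' T.W n)) : φ '' T.D n ⊆ A := by
  have h1 := T.image_mem_cuts h φ.symm
  rw [← Set.image_comp] at h1
  have h2 : (φ.symm ∘ φ : V → V) = id := funext φ.symm_apply_apply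
  rw [h2, Set.image_id] at h1
  rintro _ ⟨x, hx, rfl⟩
  obtain ⟨y, hy, rfl⟩ := hx _ h1
  rwa [φ.apply_symm_apply]

theorem D_subset_A (n : ℕ) : T.D n ⊆ T.A (n + 1) := Set.sInter_subset_of_mem (T.A_mem_cuts n)

/-- Finitely many boundary vertices of the intersection `D n` are already boundary vertices of a
finite intersection, hence there are at most `k` of them. -/
theorem D_mem_cuts (n : ℕ) : T.D n ∈ T.cuts n (T.W n) := by
  have hbd : ∀ x ∈ bdry G (T.D n), ∃ A ∈ T.cuts n (T.W n), x ∈ bdry G A := by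
    rintro x ⟨hx, y, hy, hxy⟩
    simp only [D, Set.mem_sInter, not_forall] at hy
    obtain ⟨A, hA, hyA⟩ := hy
    exact ⟨A, hA, hx A hA, y, hyA, hxy⟩
  have hfin : ∀ t : Set V, t.Finite → t ⊆ bdry G (T.D n) →
      ∃ A ∈ T.cuts n (T.W n), t ⊆ bdry G A := by
    intro t ht
    induction t, ht using Set.Finite.induction_on with
    | empty => exact fun _ => ⟨_, T.A_mem_cuts n, Set.empty_subset _⟩
    | insert _ _ ih =>
      intro hsub
      rw [Set.insert_subset_iff] at hsub
      obtain ⟨A, hA, htA⟩ := ih hsub.2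
      obtain ⟨B, hB, hxB⟩ := hbd _ hsub.1
      refine ⟨A ∩ B, T.inter_mem_cuts (T.big_W n) hA hB, Set.insert_subset ?_ fun y hy => ?_⟩
      · obtain ⟨-, z, hz, h⟩ := hxB
        exact ⟨⟨hsub.1.1 A hA, hsub.1.1 B hB⟩, z, fun h' => hz h'.2, h⟩
      · obtain ⟨-, z, hz, h⟩ := htA hy
        exact ⟨⟨(hsub.2 hy).1 A hA, (hsub.2 hy).1 B hB⟩, z, fun h' => hz h'.1, h⟩
  refine ⟨(T.rayFree (n + 1)).mono (T.D_subset_A n), ?_, ?_,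
    Set.subset_sInter fun A hA => hA.2.2.2⟩
  · by_contra hk
    have hk' : ((k + 1 : ℕ) : ℕ∞) ≤ (bdry G (T.D n)).encard := by
      rw [Nat.cast_succ]
      exact Order.add_one_le_of_lt (not_le.1 hk)
    obtain ⟨t, ht, hcard⟩ := Set.exists_subset_encard_eq hk'
    obtain ⟨A, hA, htA⟩ := hfin t (Set.finite_of_encard_eq_coe hcard) ht
    have h := (Set.encard_le_encard htA).trans hA.2.1
    rw [hcard] at h
    exact absurd (by exact_mod_cast h) (Nat.not_succ_le_self k)
  · rw [Set.disjoint_left]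
    intro x hx hx'
    obtain ⟨A, hA, hxA⟩ := hbd x hx'
    exact Set.disjoint_left.1 hA.2.2.1 hx hxA

theorem image_D_mem_cuts (n : ℕ) (φ : G ≃g G) : φ '' T.D n ∈ T.cuts n (φ '' T.W n) :=
  T.image_mem_cuts (T.D_mem_cuts n) φ

/-- A translate of `W m` does not cross a member of a later or the same level. -/
theorem image_W_subset_or_disjoint {m n : ℕ} (h : m ≤ n) (φ ψ : G ≃g G) :
    φ '' T.W m ⊆ intr G (ψ '' T.D n) ∨ Disjoint (φ '' T.W m) (ψ '' T.D n) :=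
  ((T.preconnected_W m).image φ).subset_intr_or_disjoint
    ((T.image_D_mem_cuts n ψ).2.2.1.mono_left (T.image_W_subset_U h φ))

theorem image_W_subset_intr (n : ℕ) (φ : G ≃g G) : φ '' T.W n ⊆ intr G (φ '' T.D n) := by
  intro x hx
  by_contra hx'
  exact Set.disjoint_left.1 (T.image_D_mem_cuts n φ).2.2.1 (T.image_W_subset_U le_rfl φ hx)
    (mem_bdry_of_mem_of_notMem_intr ((T.image_D_mem_cuts n φ).2.2.2 hx) hx')

theorem image_D_subset_or_disjoint {m n : ℕ} (h : m < n) (φ ψ : G ≃g G) :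
    φ '' T.D m ⊆ intr G (ψ '' T.D n) ∨ Disjoint (φ '' T.D m) (ψ '' T.D n) := by
  have hsub : φ '' T.D m ⊆ φ '' T.W (m + 1) :=
    Set.image_mono ((T.D_subset_A m).trans (T.A_subset_W (m + 1)))
  exact (T.image_W_subset_or_disjoint (show m + 1 ≤ n from h) φ ψ).imp hsub.trans
    fun h' => h'.mono_left hsub

theorem sdiff_intr_mem_cuts {n : ℕ} {S A B : Set V} (hA : A ∈ T.cuts n S) {S' : Set V}
    (hB : B ∈ T.cuts n S') (hSB : Disjoint S (intr G B))
    (hle : (bdry G (A \ intr G B)).encard ≤ k) : A \ intr G B ∈ T.cuts n S := by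
  refine ⟨hA.1.mono Set.sdiff_subset, hle, ?_,
    fun x hx => ⟨hA.2.2.2 hx, Set.disjoint_left.1 hSB hx⟩⟩
  rw [Set.disjoint_left]
  rintro x hx ⟨⟨hxA, hxB⟩, y, hy, hxy⟩
  by_cases hyA : y ∈ A
  · have hyB : y ∈ intr G B := by_contra fun h => hy ⟨hyA, h⟩
    exact Set.disjoint_left.1 hB.2.2.1 hx
      (mem_bdry_of_mem_of_notMem_intr (hyB.2 x hxy.symm) hxB)
  · exact Set.disjoint_left.1 hA.2.2.1 hx ⟨hxA, y, hyA, hxy⟩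

/-- A member of a level does not contain another member of the same level. -/
theorem D_subset_image_of_image_subset {n : ℕ} (hk : 0 < k) (θ : G ≃g G) (h : θ '' T.D n ⊆ T.D n) :
    T.D n ⊆ θ '' T.D n := by
  have hD := T.D_mem_cuts n
  have hθ := T.image_D_mem_cuts n θ
  have hbig : Big G k (T.D n) := (T.big_W n).mono hD.2.2.2
  have hbd : bdry G (T.D n) = bdry G (θ '' T.D n) := by
    have h1 : T.D n ⊆ θ.symm '' T.D n := fun x hx =>
      ⟨θ x, h ⟨x, hx, rfl⟩, θ.symm_apply_apply x⟩
    have h2 := hD.1.bdry_eq_of_subset_image hbig hD.2.1 θ.symm h1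
    rw [bdry_image] at h2 ⊢
    conv_rhs => rw [h2, ← Set.image_comp]
    ext x
    simp
  have hid : T.D n = (1 : G ≃g G) '' T.D n := by simp
  have hidW : T.W n = (1 : G ≃g G) '' T.W n := by simp
  rcases T.image_W_subset_or_disjoint (le_refl n) 1 θ with h' | h'
  · have := T.D_subset_of_mem_cuts (n := n) 1 (A := θ '' T.D n)
      ⟨hθ.1, hθ.2.1, hθ.2.2.1, h'.trans intr_subset⟩
    rwa [← hid] at this
  · -- Otherwise `θ '' D n` could be cut off from `D n` without changing the boundary.
    exfalso
    rw [← hidW] at h'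
    have hmem : T.D n \ intr G (θ '' T.D n) ∈ T.cuts n (T.W n) := by
      refine T.sdiff_intr_mem_cuts hD hθ (h'.mono_right intr_subset) ?_
      refine (Set.encard_le_encard ?_).trans hD.2.1
      rintro x ⟨⟨hx, hxB⟩, y, hy, hxy⟩
      by_cases hyA : y ∈ T.D n
      · have hyB : y ∈ intr G (θ '' T.D n) := by_contra fun h => hy ⟨hyA, h⟩
        rw [hbd]
        exact mem_bdry_of_mem_of_notMem_intr (hyB.2 x hxy.symm) hxB
      · exact ⟨hx, y, hyA, hxy⟩
    obtain ⟨R, hR, -⟩ := (T.big_W n).image θ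
    have hx := T.image_W_subset_intr n θ (hR ⟨0, hk⟩)
    exact (Set.sInter_subset_of_mem hmem (h hx.1)).2 hx

/-- Two members of the same level are equal or do not overlap beyond their boundaries. -/
theorem image_D_eq_or_disjoint {n : ℕ} (hk : 0 < k) (φ ψ : G ≃g G) :
    φ '' T.D n = ψ '' T.D n ∨ Disjoint (φ '' T.D n) (intr G (ψ '' T.D n)) := by
  have key : ∀ φ ψ : G ≃g G, φ '' T.W n ⊆ intr G (ψ '' T.D n) → φ '' T.D n = ψ '' T.D n := by
    intro φ ψ h
    have h1 := T.image_D_mem_cuts n ψ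
    have h2 : φ '' T.D n ⊆ ψ '' T.D n :=
      T.D_subset_of_mem_cuts φ ⟨h1.1, h1.2.1, h1.2.2.1, h.trans intr_subset⟩
    refine h2.antisymm ?_
    have h3 : (ψ⁻¹ * φ : G ≃g G) '' T.D n ⊆ T.D n := by
      rintro _ ⟨x, hx, rfl⟩
      obtain ⟨y, hy, hyx⟩ := h2 ⟨x, hx, rfl⟩
      rw [RelIso.mul_apply, ← hyx]
      change ψ.symm (ψ y) ∈ _
      rwa [ψ.symm_apply_apply]
    rintro _ ⟨x, hx, rfl⟩
    obtain ⟨y, hy, hyx⟩ := T.D_subset_image_of_image_subset hk _ h3 hx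
    refine ⟨y, hy, ?_⟩
    rw [← hyx, ← RelIso.mul_apply, mul_inv_cancel_left]
  rcases T.image_W_subset_or_disjoint (le_refl n) φ ψ with h | h
  · exact .inl (key φ ψ h)
  rcases T.image_W_subset_or_disjoint (le_refl n) ψ φ with h' | h'
  · exact .inl (key ψ φ h').symm
  right
  have h1 := T.image_D_mem_cuts n φ
  have h2 := T.image_D_mem_cuts n ψ
  -- Both corners contain a translate of `W n`, so that submodularity bounds their boundaries; by
  -- minimality `φ '' D n` is contained in its corner.
  have h3 : φ '' T.D n \ intr G (ψ '' T.D n) ∈ T.cuts n (φ '' T.W n) := by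
    refine T.sdiff_intr_mem_cuts h1 h2 (h.mono_right intr_subset)
      (encard_bdry_sdiff_intr_le h1.2.1 h2.2.1 ?_)
    refine Big.le_encard_bdry (((T.big_W n).image ψ).mono fun x hx => ⟨h2.2.2.2 hx, fun hx' => ?_⟩)
      (h2.1.mono Set.sdiff_subset)
    exact Set.disjoint_left.1 h' hx hx'.1
  exact Set.disjoint_left.2 fun x hx => (T.D_subset_of_mem_cuts φ h3 hx).2

end Tower

/-- A family of ray-free sets with exactly `k` boundary vertices, divided into levels, that is
nested, invariant under automorphisms, and covers the graph. -/
structure LevelSystem (G : SimpleGraph V) (k : ℕ) where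
  /-- The `n`-th level. -/
  level : ℕ → Set (Set V)
  nonempty : (level 0).Nonempty
  rayFree : ∀ {n D}, D ∈ level n → RayFree G D
  encard_eq : ∀ {n D}, D ∈ level n → (bdry G D).encard = k
  intr_nonempty : ∀ {n D}, D ∈ level n → (intr G D).Nonempty
  subset_or_disjoint : ∀ {m n D E}, D ∈ level m → E ∈ level n → m < n →
    D ⊆ intr G E ∨ Disjoint D E
  eq_or_disjoint : ∀ {n D E}, D ∈ level n → E ∈ level n → D = E ∨ Disjoint D (intr G E)
  exists_mem : ∀ (x y : V) (n : ℕ), ∃ m, n < m ∧ ∃ D ∈ level m, x ∈ intr G D ∧ y ∈ intr G D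
  exists_succ : ∀ {n D}, D ∈ level n → ∃ E ∈ level (n + 1), D ⊆ intr G E
  image_mem : ∀ {n D} (φ : G ≃g G), D ∈ level n → φ '' D ∈ level n

/-- The translates of the sets `T.D n` form a system of levels. -/
theorem Tower.exists_levelSystem (T : Tower G k) (hk : 0 < k) : Nonempty (LevelSystem G k) := by
  have hDD : ∀ m n, m < n → T.D m ⊆ intr G (T.D n) := fun m n hmn => by
    have h1 : T.A (m + 1) ⊆ T.W n := by
      rcases (show m + 1 ≤ n from hmn).eq_or_lt with rfl | h
      · exact T.A_subset_W _
      · exact (T.A_subset_intr h).trans (intr_subset.trans (T.A_subset_W n))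
    have h2 := T.image_W_subset_intr n 1
    simp only [RelIso.coe_one, Set.image_id] at h2
    exact (T.D_subset_A m).trans (h1.trans h2)
  refine ⟨⟨fun n => Set.range fun φ : G ≃g G => φ '' T.D n, ⟨_, 1, rfl⟩, ?_, ?_, ?_, ?_, ?_, ?_,
    ?_, ?_⟩⟩
  · rintro n _ ⟨φ, rfl⟩
    exact (T.image_D_mem_cuts n φ).1
  · rintro n _ ⟨φ, rfl⟩
    have h := T.image_D_mem_cuts n φ
    exact le_antisymm h.2.1 ((((T.big_W n).image φ).mono h.2.2.2).le_encard_bdry h.1)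
  · rintro n _ ⟨φ, rfl⟩
    obtain ⟨R, hR, -⟩ := (T.big_W n).image φ
    exact ⟨_, T.image_W_subset_intr n φ (hR ⟨0, hk⟩)⟩
  · rintro m n _ _ ⟨φ, rfl⟩ ⟨ψ, rfl⟩ h
    exact T.image_D_subset_or_disjoint h φ ψ
  · rintro n _ _ ⟨φ, rfl⟩ ⟨ψ, rfl⟩
    exact T.image_D_eq_or_disjoint hk φ ψ
  · intro x y n
    obtain ⟨a, ha⟩ := T.exists_mem x
    obtain ⟨b, hb⟩ := T.exists_mem y
    have hA : ∀ i x, x ∈ T.A i → x ∈ intr G (T.D (a + b + n + 1 + i)) := by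
      intro i x hx
      have h1 : x ∈ T.D i := (T.D_mem_cuts i).2.2.2 (T.A_subset_W i hx)
      exact hDD i _ (by omega) h1
    have hle : ∀ i j, i ≤ j → intr G (T.D i) ⊆ intr G (T.D j) := by
      intro i j hij
      rcases hij.eq_or_lt with rfl | h
      · exact subset_rfl
      · exact intr_subset.trans (hDD i j h)
    refine ⟨a + b + n + 1 + a + b, by omega, T.D (a + b + n + 1 + a + b),
      ⟨1, by simp⟩, ?_, ?_⟩
    · exact hle _ _ (by omega) (hA a x ha)
    · exact hle _ _ (by omega) (hA b y hb)
  · rintro n _ ⟨φ, rfl⟩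
    refine ⟨_, ⟨φ, rfl⟩, ?_⟩
    rw [intr_image]
    exact Set.image_mono (hDD n (n + 1) (Nat.lt_succ_self n))
  · rintro n _ φ ⟨ψ, rfl⟩
    refine ⟨φ * ψ, ?_⟩
    ext x
    simp [RelIso.mul_apply]

end Levels

/-! ### One-ended trees from parent maps -/

section ParentTree

variable {I : Type v}

/-- A map `parent` that raises levels by one and eventually identifies any two elements. -/
structure ParentMap (I : Type v) where
  /-- The next element on the way to the end. -/
  parent : I → I
  /-- The height of an element. -/
  lev : I → ℕ
  lev_parent : ∀ i, lev (parent i) = lev i + 1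
  exists_iterate_eq : ∀ i j, ∃ m n, parent^[m] i = parent^[n] j

namespace ParentMap

variable (P : ParentMap I)

/-- The tree that joins every element to its parent. -/
def tree : SimpleGraph I where
  Adj i j := P.parent i = j ∨ P.parent j = i
  symm := ⟨fun _ _ h => h.symm⟩
  loopless := ⟨fun i h => by
    have h1 := P.lev_parent i
    have h2 : P.parent i = i := h.elim id id
    rw [h2] at h1
    omega⟩

theorem adj_parent (i : I) : P.tree.Adj i (P.parent i) := .inl rfl

theorem lev_iterate (n : ℕ) (i : I) : P.lev (P.parent^[n] i) = P.lev i + n := by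
  induction n generalizing i with
  | zero => rfl
  | succ n ih =>
    rw [Function.iterate_succ_apply, ih, P.lev_parent]
    omega

/-- The elements that `s` is above of, including `s`. -/
def desc (s : I) : Set I := {w | ∃ n, P.parent^[n] w = s}

theorem parent_notMem_desc (s : I) : P.parent s ∉ P.desc s := by
  rintro ⟨n, hn⟩
  have h1 := P.lev_iterate n (P.parent s)
  rw [hn, P.lev_parent] at h1
  omega

theorem mem_desc_of_parent {s w : I} (h : P.parent w ∈ P.desc s) : w ∈ P.desc s := by
  obtain ⟨n, hn⟩ := h
  exact ⟨n + 1, hn⟩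

theorem deleteEdges_adj_parent {s i : I} (h : i ≠ s) :
    (P.tree.deleteEdges {s(s, P.parent s)}).Adj i (P.parent i) := by
  rw [SimpleGraph.deleteEdges_adj]
  refine ⟨P.adj_parent i, fun he => ?_⟩
  rw [Set.mem_singleton_iff, Sym2.eq_iff] at he
  rcases he with ⟨h1, -⟩ | ⟨h1, h2⟩
  · exact h h1
  · have h3 := P.lev_parent i
    have h4 := P.lev_parent s
    rw [h2, h1] at h3
    omega

theorem reachable_iterate {s i : I} {n : ℕ} (h : ∀ m < n, P.parent^[m] i ≠ s) :
    (P.tree.deleteEdges {s(s, P.parent s)}).Reachable i (P.parent^[n] i) := by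
  induction n with
  | zero => exact .rfl
  | succ n ih =>
    rw [Function.iterate_succ_apply']
    exact (ih fun m hm => h m (by omega)).trans
      (P.deleteEdges_adj_parent (h n (by omega))).reachable

theorem mem_desc_of_reachable {s u v : I} (hu : u ∈ P.desc s)
    (h : (P.tree.deleteEdges {s(s, P.parent s)}).Reachable u v) : v ∈ P.desc s := by
  obtain ⟨p⟩ := h
  induction p with
  | nil => exact hu
  | @cons a b c hab p ih =>
    apply ih
    rw [SimpleGraph.deleteEdges_adj] at hab
    rcases hab.1 with rfl | rfl
    · obtain ⟨n, hn⟩ := hu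
      rcases n with _ | n
      · obtain rfl : a = s := hn
        exact absurd rfl hab.2
      · exact ⟨n, hn⟩
    · exact P.mem_desc_of_parent hu

theorem edgeSide_parent (s : I) : edgeSide P.tree s (P.parent s) = P.desc s := by
  ext w
  constructor
  · exact fun h => P.mem_desc_of_reachable ⟨0, rfl⟩ h
  · rintro ⟨n, rfl⟩
    refine (P.reachable_iterate fun m hm h => ?_).symm
    have h1 := P.lev_iterate m w
    have h2 := P.lev_iterate n w
    rw [h] at h1
    omega

theorem edgeSide_parent' (s : I) : edgeSide P.tree (P.parent s) s = (P.desc s)ᶜ := by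
  have hswap : s(P.parent s, s) = s(s, P.parent s) := Sym2.eq_swap
  ext w
  simp only [edgeSide, hswap]
  constructor
  · intro h hw
    exact P.parent_notMem_desc s (P.mem_desc_of_reachable hw (SimpleGraph.Reachable.symm h))
  · intro hw
    obtain ⟨m, n, hmn⟩ := P.exists_iterate_eq w (P.parent s)
    have h1 := P.reachable_iterate (s := s) (i := w) (n := m) fun j _ h => hw ⟨j, h⟩
    have h2 := P.reachable_iterate (s := s) (i := P.parent s) (n := n)
      fun j _ h => P.parent_notMem_desc s ⟨j, h⟩
    rw [hmn] at h1
    exact h2.trans h1.symm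

theorem isTree [Nonempty I] : P.tree.IsTree := by
  have hup : ∀ i n, P.tree.Reachable i (P.parent^[n] i) := by
    intro i n
    induction n with
    | zero => exact .rfl
    | succ n ih =>
      rw [Function.iterate_succ_apply']
      exact ih.trans (P.adj_parent _).reachable
  refine ⟨⟨fun i j => ?_⟩, ?_⟩
  · obtain ⟨m, n, h⟩ := P.exists_iterate_eq i j
    have h1 := hup i m
    rw [h] at h1
    exact h1.trans (hup j n).symm
  · rw [SimpleGraph.isAcyclic_iff_forall_adj_isBridge]
    have key : ∀ i, P.tree.IsBridge s(i, P.parent i) := by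
      intro i
      rw [SimpleGraph.isBridge_iff]
      exact fun h => P.parent_notMem_desc i (P.mem_desc_of_reachable ⟨0, rfl⟩ h)
    rintro i j (rfl | rfl)
    · exact key i
    · rw [Sym2.eq_swap]
      exact key j

/-- The ray that goes up from `i`. -/
def upRay (i : I) : Ray P.tree where
  vert n := P.parent^[n] i
  injective m n h := by
    have h1 := P.lev_iterate m i
    have h2 := P.lev_iterate n i
    have h : P.parent^[m] i = P.parent^[n] i := h
    rw [h] at h1
    omega
  adj n := by
    rw [Function.iterate_succ_apply']
    exact P.adj_parent _

/-- Every ray goes up: one that went down once would have to go down forever. -/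
theorem ray_vert (r : Ray P.tree) (n : ℕ) : r.vert n = P.parent^[n] (r.vert 0) := by
  have hup : ∀ n, P.parent (r.vert n) = r.vert (n + 1) := by
    intro n
    by_contra hn
    have h0 := (r.adj n).resolve_left hn
    have hdown : ∀ m, P.parent (r.vert (n + m + 1)) = r.vert (n + m) := by
      intro m
      induction m with
      | zero => exact h0
      | succ m ih =>
        refine (r.adj (n + m + 1)).resolve_left fun h => ?_
        have := r.injective (ih.symm.trans h)
        omega
    have hlev : ∀ m, P.lev (r.vert (n + m)) + m = P.lev (r.vert n) := by
      intro m
      induction m with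
      | zero => rfl
      | succ m ih =>
        have := P.lev_parent (r.vert (n + m + 1))
        rw [hdown] at this
        rw [← add_assoc n m 1]
        omega
    have := hlev (P.lev (r.vert n) + 1)
    omega
  induction n with
  | zero => rfl
  | succ n ih => rw [← hup, ih, Function.iterate_succ_apply']

theorem equivalent (r r' : Ray P.tree) : r.Equivalent r' := by
  intro S hS
  obtain ⟨C, N, hN⟩ := r.exists_component hS
  obtain ⟨a, b, hab⟩ := P.exists_iterate_eq (r.vert 0) (r'.vert 0)
  refine ⟨C, ⟨N, hN⟩, N + b, fun n hn => ?_⟩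
  have h : r'.vert n = r.vert (n - b + a) := by
    rw [P.ray_vert r, P.ray_vert r', Function.iterate_add_apply, hab, ← Function.iterate_add_apply]
    congr 2
    omega
  rw [h]
  exact hN _ (by omega)

/-- The only end of the tree. -/
def treeEnd (i : I) : GraphEnd P.tree := Quotient.mk (raySetoid P.tree) (P.upRay i)

theorem isOnlyEnd (i : I) : IsOnlyEnd P.tree (P.treeEnd i) := by
  intro ν
  induction ν using Quotient.inductionOn with
  | _ r => exact Quotient.sound (P.equivalent r _)

theorem belongsTo (i : I) (r : Ray P.tree) : r.BelongsTo (P.treeEnd i) :=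
  Quotient.sound (P.equivalent r _)

/-- Sets of tree vertices that consist of one element `s` and some elements with parent `s` are
closed under taking paths. -/
theorem mem_of_mem_path [Nonempty I] {X : Set I} {s : I} (hs : s ∈ X)
    (hX : ∀ t ∈ X, t = s ∨ P.parent t = s) {t₁ t₂ t₃ : I} (p : P.tree.Path t₁ t₃)
    (hp : t₂ ∈ p.1.support) (h₁ : t₁ ∈ X) (h₃ : t₃ ∈ X) : t₂ ∈ X := by
  classical
  have hw : ∀ t ∈ X, ∃ q : P.tree.Walk t s, ∀ u ∈ q.support, u ∈ X := by
    intro t ht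
    rcases hX t ht with rfl | rfl
    · exact ⟨.nil, by simpa using ht⟩
    · refine ⟨.cons (P.adj_parent t) .nil, ?_⟩
      simpa using ⟨ht, hs⟩
  obtain ⟨q₁, hq₁⟩ := hw t₁ h₁
  obtain ⟨q₃, hq₃⟩ := hw t₃ h₃
  have hpq : p = (q₁.append q₃.reverse).toPath :=
    (P.isTree.isAcyclic.subsingleton_path t₁ t₃).elim _ _
  rw [hpq] at hp
  have h := SimpleGraph.Walk.support_bypass_subset_support _ hp
  rw [SimpleGraph.Walk.mem_support_append_iff, SimpleGraph.Walk.support_reverse,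
    List.mem_reverse] at h
  exact h.elim (hq₁ _) (hq₃ _)

end ParentMap

end ParentTree

/-! ### The tree-decomposition of a system of levels -/

section Decomposition

variable {V : Type u} {G : SimpleGraph V} {k : ℕ}

namespace LevelSystem

variable (L : LevelSystem G k)

/-- The nodes of the decomposition tree: the sets of the system, each with its level. -/
def Node : Type u := {p : ℕ × Set V // p.2 ∈ L.level p.1}

variable {L}

/-- The level of a node. -/
def Node.lev (s : L.Node) : ℕ := s.1.1

/-- The set of vertices of a node. -/
def Node.set (s : L.Node) : Set V := s.1.2

theorem Node.mem (s : L.Node) : s.set ∈ L.level s.lev := s.2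

theorem Node.eq_of_mem {s t : L.Node} (h : s.lev = t.lev) {x : V} (hs : x ∈ s.set)
    (ht : x ∈ intr G t.set) : s = t := by
  refine Subtype.ext (Prod.ext h ?_)
  have h1 := s.mem
  rw [h] at h1
  exact (L.eq_or_disjoint h1 t.mem).resolve_right fun h' => Set.disjoint_left.1 h' hs ht

theorem Node.exists_parent (s : L.Node) :
    ∃ t : L.Node, t.lev = s.lev + 1 ∧ s.set ⊆ intr G t.set := by
  obtain ⟨E, hE, h⟩ := L.exists_succ s.mem
  exact ⟨⟨(s.lev + 1, E), hE⟩, rfl, h⟩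

/-- The node of the next level whose set contains the set of `s`. -/
noncomputable def Node.parent (s : L.Node) : L.Node := s.exists_parent.choose

theorem Node.lev_parent (s : L.Node) : s.parent.lev = s.lev + 1 := s.exists_parent.choose_spec.1

theorem Node.set_subset (s : L.Node) : s.set ⊆ intr G s.parent.set :=
  s.exists_parent.choose_spec.2

theorem Node.set_subset_iterate (s : L.Node) (n : ℕ) : s.set ⊆ (Node.parent^[n] s).set := by
  induction n with
  | zero => exact subset_rfl
  | succ n ih =>
    rw [Function.iterate_succ_apply']
    exact ih.trans ((Node.set_subset _).trans intr_subset)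

theorem Node.lev_iterate (s : L.Node) (n : ℕ) : (Node.parent^[n] s).lev = s.lev + n := by
  induction n with
  | zero => rfl
  | succ n ih =>
    rw [Function.iterate_succ_apply', Node.lev_parent, ih]
    rfl

/-- A node whose interior contains `x` has every node of the same or a higher level whose interior
contains `x` above it. -/
theorem Node.iterate_parent_eq {s t : L.Node} (h : s.lev ≤ t.lev) {x : V}
    (hs : x ∈ intr G s.set) (ht : x ∈ intr G t.set) : Node.parent^[t.lev - s.lev] s = t :=
  Node.eq_of_mem (by rw [Node.lev_iterate]; omega)
    (s.set_subset_iterate _ (intr_subset hs)) ht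

variable (L)

/-- The parent map on the nodes. -/
noncomputable def parentMap : ParentMap L.Node where
  parent := Node.parent
  lev := Node.lev
  lev_parent := Node.lev_parent
  exists_iterate_eq i j := by
    obtain ⟨x, hx⟩ := L.intr_nonempty i.mem
    obtain ⟨y, hy⟩ := L.intr_nonempty j.mem
    obtain ⟨m, hm, E, hE, hxE, hyE⟩ := L.exists_mem x y (i.lev + j.lev)
    let t : L.Node := ⟨(m, E), hE⟩
    have ht : t.lev = m := rfl
    exact ⟨_, _, (Node.iterate_parent_eq (t := t) (by omega) hx hxE).trans
      (Node.iterate_parent_eq (t := t) (by omega) hy hyE).symm⟩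

variable {L}

/-- The part of a node: its set without the interiors of the sets of its children. -/
def Node.part (s : L.Node) : Set V := {x ∈ s.set | ∀ c : L.Node, c.parent = s → x ∉ intr G c.set}

variable (L) in
theorem exists_home (x : V) : ∃ s : L.Node, x ∈ intr G s.set ∧
    ∀ t : L.Node, x ∈ intr G t.set → s.lev ≤ t.lev := by
  obtain ⟨m, -, E, hE, hx, -⟩ := L.exists_mem x x 0
  obtain ⟨n, ⟨s, hs, rfl⟩, hmin⟩ := (wellFounded_lt (α := ℕ)).has_min
    {n | ∃ s : L.Node, x ∈ intr G s.set ∧ s.lev = n} ⟨m, ⟨(m, E), hE⟩, hx, rfl⟩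
  exact ⟨s, hs, fun t ht => not_lt.1 (hmin _ ⟨t, ht, rfl⟩)⟩

variable (L) in
/-- The node of least level whose interior contains `x`. -/
noncomputable def home (x : V) : L.Node := (L.exists_home x).choose

theorem mem_intr_home (x : V) : x ∈ intr G (L.home x).set := (L.exists_home x).choose_spec.1

theorem lev_home_le {x : V} {t : L.Node} (h : x ∈ intr G t.set) : (L.home x).lev ≤ t.lev :=
  (L.exists_home x).choose_spec.2 t h

theorem mem_part_of_lev_le {x : V} {s : L.Node} (hx : x ∈ s.set)
    (h : s.lev ≤ (L.home x).lev) : x ∈ s.part := by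
  refine ⟨hx, ?_⟩
  rintro c rfl hc
  have h1 := lev_home_le hc
  rw [Node.lev_parent] at h
  omega

theorem mem_part_home (x : V) : x ∈ (L.home x).part :=
  mem_part_of_lev_le (intr_subset (mem_intr_home x)) le_rfl

/-- Besides its home, only children of its home contain a given vertex in their parts. -/
theorem eq_home_or_parent_eq_home {x : V} {t : L.Node} (h : x ∈ t.part) :
    t = L.home x ∨ t.parent = L.home x := by
  have hs := mem_intr_home (L := L) x
  rcases lt_trichotomy t.lev (L.home x).lev with hlt | heq | hlt
  · right
    have h1 := t.set_subset h.1
    have h2 := lev_home_le h1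
    rw [Node.lev_parent] at h2
    exact Node.eq_of_mem (by rw [Node.lev_parent]; omega) (intr_subset h1) hs
  · exact .inl (Node.eq_of_mem heq h.1 hs)
  · exfalso
    let c := Node.parent^[t.lev - 1 - (L.home x).lev] (L.home x)
    have hc : x ∈ intr G c.set := intr_mono ((L.home x).set_subset_iterate _) hs
    refine h.2 c (Node.eq_of_mem ?_ h.1 (c.set_subset (intr_subset hc))).symm hc
    rw [Node.lev_parent, Node.lev_iterate]
    omega

theorem home_mem_desc_iff {x : V} {s : L.Node} :
    L.home x ∈ L.parentMap.desc s ↔ x ∈ intr G s.set := by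
  constructor
  · rintro ⟨n, rfl⟩
    exact intr_mono ((L.home x).set_subset_iterate n) (mem_intr_home x)
  · exact fun h => ⟨_, Node.iterate_parent_eq (lev_home_le h) (mem_intr_home x) h⟩

variable (L)

theorem nonempty_node : Nonempty L.Node :=
  ⟨⟨(0, L.nonempty.choose), L.nonempty.choose_spec⟩⟩

/-- The tree-decomposition whose associated separations are given by the sets of the system. -/
noncomputable def treeDecomposition : TreeDecomposition G L.Node where
  tree := L.parentMap.tree
  isTree := by
    have := L.nonempty_node
    exact L.parentMap.isTree
  part := Node.part
  exists_mem_part x := ⟨_, mem_part_home x⟩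
  exists_edge_part x y hxy := by
    have key : ∀ x y, G.Adj x y → (L.home x).lev ≤ (L.home y).lev → y ∈ (L.home x).part :=
      fun x y hxy h => mem_part_of_lev_le ((mem_intr_home x).2 y hxy) h
    rcases le_total (L.home x).lev (L.home y).lev with h | h
    · exact ⟨_, mem_part_home x, key x y hxy h⟩
    · exact ⟨_, key y x hxy.symm h, mem_part_home y⟩
  inter_subset := by
    rintro t₁ t₂ t₃ p hp x ⟨h₁, h₃⟩
    have := L.nonempty_node
    exact L.parentMap.mem_of_mem_path (X := {t | x ∈ t.part}) (mem_part_home x)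
      (fun t ht => eq_home_or_parent_eq_home ht) p hp h₁ h₃

theorem side_parent (s : L.Node) : L.treeDecomposition.side s s.parent = s.set := by
  have h : edgeSide L.treeDecomposition.tree s s.parent = L.parentMap.desc s :=
    L.parentMap.edgeSide_parent s
  rw [TreeDecomposition.side, h]
  ext x
  simp only [Set.mem_iUnion]
  constructor
  · rintro ⟨w, ⟨n, rfl⟩, hx⟩
    exact w.set_subset_iterate n hx.1
  · intro hx
    by_cases hxi : x ∈ intr G s.set
    · exact ⟨L.home x, home_mem_desc_iff.2 hxi, mem_part_home x⟩
    · refine ⟨s, ⟨0, rfl⟩, hx, ?_⟩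
      rintro c rfl hc
      exact hxi (c.set_subset (intr_subset hc))

theorem side_parent' (s : L.Node) :
    L.treeDecomposition.side s.parent s = (intr G s.set)ᶜ := by
  have h : edgeSide L.treeDecomposition.tree s.parent s = (L.parentMap.desc s)ᶜ :=
    L.parentMap.edgeSide_parent' s
  rw [TreeDecomposition.side, h]
  ext x
  simp only [Set.mem_iUnion]
  constructor
  · rintro ⟨w, hw, hx⟩ hxi
    have hd := home_mem_desc_iff.2 hxi
    rcases eq_home_or_parent_eq_home hx with rfl | h
    · exact hw hd
    · rw [← h] at hd
      exact hw (L.parentMap.mem_desc_of_parent hd)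
  · exact fun hx => ⟨L.home x, fun h => hx (home_mem_desc_iff.1 h), mem_part_home x⟩

theorem mem_separations_iff {p : Set V × Set V} :
    p ∈ L.treeDecomposition.separations ↔
      ∃ s : L.Node, p = (s.set, (intr G s.set)ᶜ) ∨ p = ((intr G s.set)ᶜ, s.set) := by
  constructor
  · rintro ⟨s, t, (h | h), rfl⟩
    · obtain rfl : s.parent = t := h
      exact ⟨s, .inl (by rw [side_parent, side_parent'])⟩
    · obtain rfl : t.parent = s := h
      exact ⟨t, .inr (by rw [side_parent, side_parent'])⟩
  · rintro ⟨s, rfl | rfl⟩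
    · exact ⟨s, s.parent, L.parentMap.adj_parent s, by rw [side_parent, side_parent']⟩
    · exact ⟨s.parent, s, (L.parentMap.adj_parent s).symm, by rw [side_parent, side_parent']⟩

theorem adhesion_eq : L.treeDecomposition.adhesion = k := by
  have h : ∀ s : L.Node, (s.set ∩ (intr G s.set)ᶜ).encard = k := fun s => by
    rw [inter_compl_intr]
    exact L.encard_eq s.mem
  refine le_antisymm (iSup₂_le fun p hp => ?_) ?_
  · obtain ⟨s, rfl | rfl⟩ := L.mem_separations_iff.1 hp
    · exact (h s).le
    · rw [Set.inter_comm]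
      exact (h s).le
  · obtain ⟨s⟩ := L.nonempty_node
    rw [← h s]
    exact le_iSup₂ (f := fun (p : Set V × Set V) (_ : p ∈ L.treeDecomposition.separations) =>
      (p.1 ∩ p.2).encard) _ (L.mem_separations_iff.2 ⟨s, .inl rfl⟩)

theorem isProper (r : Ray G) : L.treeDecomposition.IsProper := by
  have h : ∀ s : L.Node, IsProperSeparation G s.set (intr G s.set)ᶜ := by
    intro s
    obtain ⟨N, hN⟩ := L.rayFree s.mem r
    obtain ⟨x, hx⟩ := L.intr_nonempty s.mem
    refine ⟨⟨?_, fun x hx y hy hxy => ?_⟩, ⟨x, hx.1, fun h => h hx⟩,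
      ⟨r.vert N, fun h => hN N le_rfl h.1, hN N le_rfl⟩⟩
    · rw [Set.eq_univ_iff_forall]
      exact fun x => (em (x ∈ s.set)).imp id fun h h' => h h'.1
    · exact hy.2 ((Set.notMem_compl_iff.1 hx.2).2 y hxy)
  intro p hp
  obtain ⟨s, rfl | rfl⟩ := L.mem_separations_iff.1 hp
  · exact h s
  · exact ⟨⟨by rw [Set.union_comm]; exact (h s).union_eq,
      fun x hx y hy hxy => (h s).not_adj y hy x hx hxy.symm⟩,
      (h s).right_nonempty, (h s).left_nonempty⟩

theorem displays (ω : GraphEnd G) : L.treeDecomposition.Displays ω := by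
  obtain ⟨i⟩ := L.nonempty_node
  refine ⟨by rw [adhesion_eq]; exact ENat.natCast_ne_top k, L.parentMap.treeEnd i,
    L.parentMap.isOnlyEnd i, ?_⟩
  rintro s t (h | h) hμ
  · obtain rfl : s.parent = t := h
    intro r _
    obtain ⟨N, hN⟩ := L.rayFree s.mem r
    refine ⟨N, fun n hn => ?_⟩
    rw [side_parent']
    exact fun h => hN n hn h.1
  · -- The end of the tree does not lie below the node `t`.
    exfalso
    obtain rfl : t.parent = s := h
    obtain ⟨N, hN⟩ := hμ (L.parentMap.upRay t.parent) (L.parentMap.belongsTo i _)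
    have h1 : (L.parentMap.upRay t.parent).vert N ∈ L.parentMap.desc t := by
      rw [← L.parentMap.edgeSide_parent t]
      exact hN N le_rfl
    obtain ⟨n, hn⟩ := h1
    have h2 := Node.lev_iterate (Node.parent^[N] t.parent) n
    rw [Node.lev_iterate t.parent N, Node.lev_parent] at h2
    have h3 : Node.parent^[n] (Node.parent^[N] t.parent) = t := hn
    rw [h3] at h2
    omega

theorem isAutInvariant : L.treeDecomposition.IsAutInvariant := by
  intro φ p hp
  obtain ⟨s, hs⟩ := L.mem_separations_iff.1 hp
  let t : L.Node := ⟨(s.lev, φ '' s.set), L.image_mem φ s.mem⟩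
  have ht : φ '' (intr G s.set)ᶜ = (intr G t.set)ᶜ := by
    rw [Set.image_compl_eq φ.bijective, ← intr_image]
    rfl
  refine L.mem_separations_iff.2 ⟨t, ?_⟩
  rcases hs with rfl | rfl
  · exact .inl (Prod.ext rfl ht)
  · exact .inr (Prod.ext ht rfl)

end LevelSystem

end Decomposition

/-! ### One-ended graphs -/

section OneEnded

variable {V : Type u} {G : SimpleGraph V}

theorem IsOnlyEnd.equivalent {ω : GraphEnd G} (h : IsOnlyEnd G ω) (r r' : Ray G) :
    r.Equivalent r' :=
  Quotient.exact ((h (Quotient.mk (raySetoid G) r)).trans (h (Quotient.mk (raySetoid G) r')).symm)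

theorem GraphEnd.Undominated.finitelySeparable {ω : GraphEnd G} (hdom : ω.Undominated)
    (h : IsOnlyEnd G ω) : FinitelySeparable G := by
  intro x
  obtain ⟨A, B, hAB, hfin, hx, hB⟩ := not_not.1 (hdom x)
  have hmemB : ∀ y, y ∉ A → y ∈ B := fun y hy =>
    (hAB.union_eq.symm ▸ Set.mem_univ y : y ∈ A ∪ B).resolve_left hy
  refine ⟨A, fun r => ?_, hfin.subset ?_, hx.1, fun y hxy => ?_⟩
  · -- A tail of `r` is in `B`, and a later tail avoids the finite set `A ∩ B`.
    obtain ⟨N, hN⟩ := hB r (h _)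
    obtain ⟨C, M, hM⟩ := r.exists_component hfin
    refine ⟨max N M, fun n hn hA => ?_⟩
    exact SimpleGraph.ComponentCompl.notMem_of_mem (hM n ((le_max_right _ _).trans hn))
      ⟨hA, hN n ((le_max_left _ _).trans hn)⟩
  · rintro y ⟨hy, z, hz, hyz⟩
    refine ⟨hy, by_contra fun hyB => ?_⟩
    exact hAB.not_adj y ⟨hy, hyB⟩ z ⟨hmemB z hz, hz⟩ hyz
  · by_contra hy
    exact hAB.not_adj x hx y ⟨hmemB y hy, hy⟩ hxy

end OneEnded

end EndTD

theorem mainTheorem1 {V : Type u} (G : SimpleGraph V) (hG : G.Connected)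
    (ω : EndTD.GraphEnd G) (hω : EndTD.IsOnlyEnd G ω) (hdom : ω.Undominated)
    (k : ℕ) (hk : ω.HasVertexDegree k) :
    ∃ (I : Type u) (D : EndTD.TreeDecomposition G I),
      D.adhesion = (k : ℕ∞) ∧ D.IsProper ∧ D.Displays ω ∧ D.IsAutInvariant := by
  obtain ⟨r, -⟩ := Quotient.exists_rep ω
  obtain ⟨⟨R, -, hR⟩, hmax⟩ := hk
  have hmax' : ∀ n, (∃ R : Fin n → EndTD.Ray G,
      Pairwise fun i j => Disjoint (Set.range (R i).vert) (Set.range (R j).vert)) → n ≤ k :=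
    fun n ⟨R, hR⟩ => hmax ⟨R, fun i => hω _, hR⟩
  have hkpos : 0 < k := hmax' 1 ⟨fun _ => r, fun i j h => absurd (Subsingleton.elim i j) h⟩
  obtain ⟨E⟩ := (hdom.finitelySeparable hω).exists_exhaustion hG hω.equivalent r hmax' ⟨R, hR⟩
  obtain ⟨T⟩ := E.exists_tower hG
  obtain ⟨L⟩ := T.exists_levelSystem hkpos
  exact ⟨L.Node, L.treeDecomposition, L.adhesion_eq, L.isProper r, L.displays ω,
    L.isAutInvariant⟩
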